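/- **Setting.** Let $d\ge 1$, $\mathcal S=\{s\in[0,1]^d:\|s\|_1\le 1\}$ and $\mathrm{Int}(\mathcal S)=\{s\in(0,1)^d:\|s\|_1<1\}$, where $\|s\|_1=\sum_{i=1}^d|s_i|$. For $\alpha\in(0,\infty)^d$ and $\beta>0$ let $$K_{\alpha,\beta}(x)=\frac{\Gamma(\|\alpha\|_1+\beta)}{\Gamma(\beta)\prod_{i=1}^d\Gamma(\alpha_i)}\,(1-\|x\|_1)^{\beta-1}\prod_{i=1}^d x_i^{\alpha_i-1},\qquad x\in\mathcal S,$$ be the Dirichlet density. Let $X_1,\dots,X_n$ be i.i.d. random vectors with a density $f$ supported on $\mathcal S$ and, for $b>0$, let $$\hat f_{n,b}(s)=\frac1n\sum_{i=1}^n K_{s/b+1,\,(1-\|s\|_1)/b+1}(X_i),\qquad s\in\mathcal S.$$ Put $\mathrm{Bias}[\hat f_{n,b}(s)]=\mathbb E[\hat f_{n,b}(s)]-f(s)$ and $\mathrm{MSE}[\hat f_{n,b}(s)]=\mathbb E\big[|\hat f_{n,b}(s)-f(s)|^2\big]$, and, for $s\in\mathrm{Int}(\mathcal S)$, $$\psi(s)=\Big[(4\pi)^d(1-\|s\|_1)\prod_{i=1}^d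 s_i\Big]^{-1/2},$$ $$g(s)=\sum_{i=1}^d\big(1-(d+1)s_i\big)\frac{\partial f}{\partial s_i}(s)+\frac12\sum_{i,j=1}^d s_i\big(\mathbf 1_{\{i=j\}}-s_j\big)\frac{\partial^2 f}{\partial s_i\partial s_j}(s).$$ **Corollary (Mean squared error).** Assume that $f$ is twice continuously differentiable on $\mathcal S$. Throughout, $s\in\mathrm{Int}(\mathcal S)$. For all $n\ge1$ and $b>0$, $\hat f_{n,b}(s)$ is square integrable, its MSE depends on the sample only through its size $n$ and the density $f$, and $$\mathrm{MSE}[\hat f_{n,b}(s)]=\mathrm{Var}(\hat f_{n,b}(s))+\big(\mathrm{Bias}[\hat f_{n,b}(s)]\big)^2 .$$ 1. As $n\to\infty$ and $b\to0^+$ (jointly), $$\mathrm{MSE}[\hat f_{n,b}(s)]=n^{-1}b^{-d/2}\psi(s)f(s)+b^2g(s)^2+\mathcal O_s\big(n^{-1}b^{-d/2+1/2}\big)+o(b^2),$$ where the constant in $\mathcal O_s$ depends only on $d$, $f$ and $s$, and the $o(b^2)$ term is uniform in $s\in\mathrm{Int}(\mathcal S)$. 2. If $f(s)g(s)\ne0$,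 then the asymptotically optimal bandwidth with respect to the MSE at $s$ is $$b_{\mathrm{opt}}(s)=n^{-2/(d+4)}\Big[\frac d4\cdot\frac{\psi(s)f(s)}{g(s)^2}\Big]^{2/(d+4)}$$ in the following sense: for every $n\ge1$ it is the unique minimiser over $b>0$ of the leading part $n^{-1}b^{-d/2}\psi(s)f(s)+b^2g(s)^2$; and for every $\varepsilon>0$ there are $n_0\in\mathbb N$ and $b_0>0$ such that $(1-\varepsilon)\,\mathrm{MSE}[\hat f_{n,b_{\mathrm{opt}}(s)}(s)]\le\mathrm{MSE}[\hat f_{n,b}(s)]$ for all $n\ge n_0$ and $0<b<b_0$. Moreover, as $n\to\infty$, $$\mathrm{MSE}[\hat f_{n,b_{\mathrm{opt}}(s)}(s)]=n^{-4/(d+4)}\left[\frac{1+\frac d4}{(\frac d4)^{d/(d+4)}}\right]\frac{(\psi(s)f(s))^{4/(d+4)}}{(g(s)^2)^{-d/(d+4)}}+o_s\big(n^{-4/(d+4)}\big).$$ 3. If $b=b(n)>0$ satisfies $n^{2/(d+4)}\,b\to\lambda$ for some $\lambda>0$, then, as $n\to\infty$, $$\mathrm{MSE}[\hat f_{n,b}(s)]=n^{-4/(d+4)}\big[\lambda^{-d/2}\psi(s)f(s)+\lambda^2g(s)^2\big]+o_s\big(n^{-4/(d+4)}\big).$$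 -/

import Mathlib

open Filter Topology Asymptotics MeasureTheory ProbabilityTheory

namespace DirichletKernel

noncomputable section

/-- The norm `‖s‖₁ = ∑ |s i|`. -/
def l1Norm {d : ℕ} (s : Fin d → ℝ) : ℝ := ∑ i, |s i|

/-- The `d`-dimensional simplex `𝒮 = {s ∈ [0,1]^d : ‖s‖₁ ≤ 1}`. -/
def simplex (d : ℕ) : Set (Fin d → ℝ) :=
  {s | (∀ i, s i ∈ Set.Icc (0 : ℝ) 1) ∧ l1Norm s ≤ 1}

/-- Its interior `{s ∈ (0,1)^d : ‖s‖₁ < 1}`. -/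
def simplexInt (d : ℕ) : Set (Fin d → ℝ) :=
  {s | (∀ i, s i ∈ Set.Ioo (0 : ℝ) 1) ∧ l1Norm s < 1}

/-- The density `K_{α,β}` of the Dirichlet distribution on the simplex. It is only ever evaluated
(almost surely) at points of the simplex. -/
def dirichletDensity {d : ℕ} (α : Fin d → ℝ) (β : ℝ) (x : Fin d → ℝ) : ℝ :=
  Real.Gamma (l1Norm α + β) / (Real.Gamma β * ∏ i, Real.Gamma (α i)) *
    ((1 - l1Norm x) ^ (β - 1) * ∏ i, x i ^ (α i - 1))

/-- The kernel `K_{s/b + 1, (1 - ‖s‖₁)/b + 1}`. -/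
def kernel {d : ℕ} (b : ℝ) (s : Fin d → ℝ) : (Fin d → ℝ) → ℝ :=
  dirichletDensity (fun i => s i / b + 1) ((1 - l1Norm s) / b + 1)

/-- The Dirichlet kernel estimator `f̂_{n,b}(s)` built on a sample `X₁, …, Xₙ`, as a random
variable. -/
def estimator {d n : ℕ} {Ω : Type*} (X : Fin n → Ω → (Fin d → ℝ)) (b : ℝ) (s : Fin d → ℝ) :
    Ω → ℝ :=
  fun ω => (1 / (n : ℝ)) * ∑ i, kernel b s (X i ω)

/-- `f` is a probability density on the simplex (values of `f` off the simplex are irrelevant). -/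
structure IsSimplexDensity {d : ℕ} (f : (Fin d → ℝ) → ℝ) : Prop where
  nonneg : ∀ x ∈ simplex d, 0 ≤ f x
  integrableOn : IntegrableOn f (simplex d)
  integral_eq_one : ∫ x in simplex d, f x = 1

/-- The distribution on the simplex with Lebesgue density `f`. -/
def simplexLaw {d : ℕ} (f : (Fin d → ℝ) → ℝ) : Measure (Fin d → ℝ) :=
  (volume.restrict (simplex d)).withDensity (fun x => ENNReal.ofReal (f x))

/-- `X₁, …, Xₙ` are i.i.d. random vectors on `(Ω, P)` with density `f` supported on the simplex. -/
structure IsSample {d n : ℕ} {Ω : Type*} [MeasurableSpace Ω] (P : Measure Ω)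
    (f : (Fin d → ℝ) → ℝ) (X : Fin n → Ω → (Fin d → ℝ)) : Prop where
  hasLaw : ∀ i, HasLaw (X i) (simplexLaw f) P
  indep : iIndepFun X P

/-- `Bias[f̂_{n,b}(s)] = E[f̂_{n,b}(s)] - f(s)`. -/
def bias {d n : ℕ} {Ω : Type*} [MeasurableSpace Ω] (P : Measure Ω) (f : (Fin d → ℝ) → ℝ)
    (X : Fin n → Ω → (Fin d → ℝ)) (b : ℝ) (s : Fin d → ℝ) : ℝ :=
  (∫ ω, estimator X b s ω ∂P) - f s

/-- `MSE[f̂_{n,b}(s)] = E[|f̂_{n,b}(s) - f(s)|²]`. -/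
def meanSquaredError {d n : ℕ} {Ω : Type*} [MeasurableSpace Ω] (P : Measure Ω)
    (f : (Fin d → ℝ) → ℝ) (X : Fin n → Ω → (Fin d → ℝ)) (b : ℝ) (s : Fin d → ℝ) : ℝ :=
  ∫ ω, |estimator X b s ω - f s| ^ 2 ∂P

/-- `ψ(s) = [(4π)^d (1 - ‖s‖₁) ∏ s_i]^{-1/2}`. -/
def psi {d : ℕ} (s : Fin d → ℝ) : ℝ :=
  ((4 * Real.pi) ^ d * (1 - l1Norm s) * ∏ i, s i) ^ (-(1 / 2) : ℝ)

/-- The partial derivative `∂f/∂s_i` (used at interior points of the simplex, where the functions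
concerned are differentiable). -/
def partialDeriv {d : ℕ} (i : Fin d) (f : (Fin d → ℝ) → ℝ) (s : Fin d → ℝ) : ℝ :=
  fderiv ℝ f s (Pi.single i 1)

/-- `g(s) = ∑ᵢ (1 - (d+1) sᵢ) ∂ᵢf(s) + ½ ∑ᵢⱼ sᵢ (1_{i=j} - sⱼ) ∂ᵢ∂ⱼf(s)`. -/
def gTerm {d : ℕ} (f : (Fin d → ℝ) → ℝ) (s : Fin d → ℝ) : ℝ :=
  ∑ i, (1 - ((d : ℝ) + 1) * s i) * partialDeriv i f s +
    (1 / 2) * ∑ i, ∑ j, s i * ((if i = j then 1 else 0) - s j) *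
      partialDeriv i (partialDeriv j f) s

/-- The leading part `n⁻¹ b^{-d/2} ψ(s) f(s) + b² g(s)²` of the mean squared error. -/
def leadingMSE {d : ℕ} (f : (Fin d → ℝ) → ℝ) (s : Fin d → ℝ) (n : ℕ) (b : ℝ) : ℝ :=
  (n : ℝ)⁻¹ * b ^ (-(d : ℝ) / 2) * (psi s * f s) + b ^ 2 * gTerm f s ^ 2

/-- `b_opt(s) = n^{-2/(d+4)} [(d/4) ψ(s) f(s) / g(s)²]^{2/(d+4)}`. -/
def bOpt {d : ℕ} (f : (Fin d → ℝ) → ℝ) (s : Fin d → ℝ) (n : ℕ) : ℝ :=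
  (n : ℝ) ^ (-2 / ((d : ℝ) + 4)) *
    ((d : ℝ) / 4 * (psi s * f s / gTerm f s ^ 2)) ^ (2 / ((d : ℝ) + 4))

end

end DirichletKernel

/-! The MSE is the variance plus the squared bias, and both reduce to `kernelMean b s f`, the
expectation of `f` under the Dirichlet law whose density is the kernel.

Bias. The Dirichlet moments are explicit rational functions of `b`: the means of `x i - s i` and of
`(x i - s i) * (x j - s j)` are `b` times the coefficients occurring in `gTerm`, up to `O(b ^ 2)`,
and the fourth central moments are `O(b ^ 2)`, all uniformly in `s`. A second order Taylor expansion
with remainder at most `ε ‖x - s‖ ^ 2 + C ‖x - s‖ ^ 4` (`taylor_simplex`) turns this into a bias `b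
* gTerm f s + o(b)`, uniform in `s` (`kernelMean_expansion`).

Variance. The square of the kernel is a constant times the kernel of bandwidth `b / 2`
(`kernel_sq`), so the second moment is that constant times a kernel mean close to `f s`. By the
duplication formula and log-convexity of Gamma the constant is `b ^ (-d / 2) * psi s * (1 + O(b))`
(`kernelConst_sq_div`, `isBigO_kernelSqError`).

Bandwidth. In the variable `u = n ^ (2 / (d + 4)) * b` the leading part is `n ^ (-4 / (d + 4)) * (A
* u ^ (-d / 2) + G * u ^ 2)`, with `A = psi s * f s` and `G = gTerm f s ^ 2`. Its minimiser is
`optScale`. When `A` and `G` are positive both remainders are negligible relative to the leading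
part as `n → ∞` and `b → 0` jointly, so minimality passes to the MSE up to a factor `1 - ε`. -/

namespace DirichletKernel

/-! ### The Dirichlet integral. -/

/-- The scaled beta integral. -/
lemma lintegral_beta_scaled {a c t : ℝ} (ha : 0 < a) (hc : 0 < c) (ht : 0 < t) :
    ∫⁻ x in Set.Icc 0 t, ENNReal.ofReal (x ^ (a - 1) * (t - x) ^ (c - 1)) =
      ENNReal.ofReal (beta a c * t ^ (a + c - 1)) := by
  have hb := beta_pos ha hc
  -- The substitution `x ↦ t * x` reduces the integral to the normalisation of the beta density.
  have himg : (fun x : ℝ => t * x) '' Set.Ioo 0 1 = Set.Ioo 0 t := by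
    rw [Set.image_mul_left_Ioo ht]; simp
  have h1 := lintegral_betaPDF_eq_one ha hc
  rw [lintegral_betaPDF] at h1
  rw [← setLIntegral_congr (Ioo_ae_eq_Icc (μ := volume) (a := (0 : ℝ)) (b := t)), ← himg,
    lintegral_image_eq_lintegral_abs_deriv_mul (f' := fun _ => t) measurableSet_Ioo
      (fun x _ => by simpa using ((hasDerivAt_id x).const_mul t).hasDerivWithinAt)
      (fun x _ y _ h => mul_left_cancel₀ ht.ne' h)]
  have h2 : ∀ x ∈ Set.Ioo (0 : ℝ) 1,
      ENNReal.ofReal |t| * ENNReal.ofReal ((t * x) ^ (a - 1) * (t - t * x) ^ (c - 1)) =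
        ENNReal.ofReal (beta a c * t ^ (a + c - 1)) *
          ENNReal.ofReal (1 / beta a c * x ^ (a - 1) * (1 - x) ^ (c - 1)) := by
    intro x hx
    have hx1 : 0 ≤ 1 - x := by linarith [hx.2]
    rw [← ENNReal.ofReal_mul (abs_nonneg _), ← ENNReal.ofReal_mul (by positivity),
      show t - t * x = t * (1 - x) by ring, Real.mul_rpow ht.le hx.1.le, Real.mul_rpow ht.le hx1,
      show a + c - 1 = 1 + (a - 1) + (c - 1) by ring, Real.rpow_add ht, Real.rpow_add ht,
      Real.rpow_one, abs_of_pos ht]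
    congr 1
    field_simp
  rw [setLIntegral_congr_fun measurableSet_Ioo h2, lintegral_const_mul _ (by fun_prop), h1, mul_one]

/-- The simplex of size `t`. -/
def scaledSimplex (d : ℕ) (t : ℝ) : Set (Fin d → ℝ) := {x | (∀ i, 0 ≤ x i) ∧ ∑ i, x i ≤ t}

lemma measurableSet_scaledSimplex (d : ℕ) (t : ℝ) : MeasurableSet (scaledSimplex d t) := by
  unfold scaledSimplex; measurability

/-- The Dirichlet integral over the simplex of size `t`. -/
lemma lintegral_dirichlet {d : ℕ} {α : Fin d → ℝ} {β t : ℝ} (hα : ∀ i, 0 < α i) (hβ : 0 < β)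
    (ht : 0 < t) :
    ∫⁻ x in scaledSimplex d t, ENNReal.ofReal ((t - ∑ i, x i) ^ (β - 1) * ∏ i, x i ^ (α i - 1)) =
      ENNReal.ofReal (Real.Gamma β * (∏ i, Real.Gamma (α i)) / Real.Gamma (∑ i, α i + β) *
        t ^ (∑ i, α i + β - 1)) := by
  -- The size must vary: fixing the first coordinate `x` leaves a simplex of size `t - x`, and
  -- integrating the resulting power of `t - x` is a scaled beta integral.
  induction d generalizing t with
  | zero =>
    have : scaledSimplex 0 t = Set.univ := by
      ext x; simp [scaledSimplex, ht.le]
    have hG := (Real.Gamma_pos_of_pos hβ).ne'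
    simp [this, lintegral_unique, hG, volume_pi]
  | succ d ih =>
    have hα' : ∀ i, 0 < α (Fin.succ i) := fun i => hα _
    set A : ℝ := ∑ i : Fin d, α i.succ with hA
    have hA0 : 0 ≤ A := Finset.sum_nonneg fun i _ => (hα' i).le
    set G : ℝ := Real.Gamma β * (∏ i : Fin d, Real.Gamma (α i.succ)) / Real.Gamma (A + β) with hG
    have hAβ : 0 < Real.Gamma (A + β) := Real.Gamma_pos_of_pos (by linarith)
    have hG0 : 0 ≤ G := div_nonneg (mul_nonneg (Real.Gamma_pos_of_pos hβ).le
      (Finset.prod_nonneg fun i _ => (Real.Gamma_pos_of_pos (hα' i)).le)) hAβ.le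
    let F : (Fin (d + 1) → ℝ) → ENNReal := (scaledSimplex (d + 1) t).indicator fun x =>
      ENNReal.ofReal ((t - ∑ i, x i) ^ (β - 1) * ∏ i, x i ^ (α i - 1))
    have hF : Measurable F := Measurable.indicator (by fun_prop) (measurableSet_scaledSimplex _ _)
    let e := MeasurableEquiv.piFinSuccAbove (fun _ : Fin (d + 1) => ℝ) 0
    have hsplit : ∀ (x : ℝ) (y : Fin d → ℝ), F (e.symm (x, y)) =
        (Set.Icc 0 t).indicator (fun x => ENNReal.ofReal (x ^ (α 0 - 1))) x *
          (scaledSimplex d (t - x)).indicator (fun y =>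
            ENNReal.ofReal ((t - x - ∑ i, y i) ^ (β - 1) * ∏ i, y i ^ (α i.succ - 1))) y := by
      intro x y
      have he : e.symm (x, y) = Fin.cons x y := by
        simp [e, MeasurableEquiv.piFinSuccAbove, Fin.insertNthEquiv]
      have hmem : Fin.cons x y ∈ scaledSimplex (d + 1) t ↔
          x ∈ Set.Icc 0 t ∧ y ∈ scaledSimplex d (t - x) := by
        simp only [scaledSimplex, Set.mem_ofPred_eq, Fin.forall_fin_succ, Fin.sum_univ_succ,
          Fin.cons_zero, Fin.cons_succ, Set.mem_Icc]
        constructor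
        · rintro ⟨⟨h1, h2⟩, h3⟩
          exact ⟨⟨h1, by linarith [Finset.sum_nonneg fun i (_ : i ∈ Finset.univ) => h2 i]⟩, h2,
            by linarith⟩
        · rintro ⟨⟨h1, _⟩, h2, h3⟩
          exact ⟨⟨h1, h2⟩, by linarith⟩
      rw [he]
      by_cases h : Fin.cons x y ∈ scaledSimplex (d + 1) t
      · obtain ⟨h1, h2⟩ := hmem.1 h
        simp only [F, Set.indicator_of_mem h, Set.indicator_of_mem h1, Set.indicator_of_mem h2]
        rw [← ENNReal.ofReal_mul (Real.rpow_nonneg h1.1 _)]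
        simp only [Fin.sum_univ_succ, Fin.prod_univ_succ, Fin.cons_zero, Fin.cons_succ, sub_sub]
        congr 1
        ring
      · simp only [F, Set.indicator_of_notMem h]
        by_cases h1 : x ∈ Set.Icc 0 t
        · rw [Set.indicator_of_notMem (fun h2 => h (hmem.2 ⟨h1, h2⟩)), mul_zero]
        · rw [Set.indicator_of_notMem h1, zero_mul]
    have hmp := (volume_preserving_piFinSuccAbove (fun _ : Fin (d + 1) => ℝ) 0).symm
    -- At `x = t` the remaining simplex has size zero, where `ih` does not apply; this is a null
    -- set.
    have hinner : ∀ x, x ≠ t → ∫⁻ y, F (e.symm (x, y)) =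
        (Set.Icc 0 t).indicator (fun x => ENNReal.ofReal G *
          ENNReal.ofReal (x ^ (α 0 - 1) * (t - x) ^ (A + β - 1))) x := by
      intro x hxt
      simp_rw [hsplit]
      rw [lintegral_const_mul _ (Measurable.indicator (by fun_prop)
        (measurableSet_scaledSimplex _ _)), lintegral_indicator (measurableSet_scaledSimplex _ _)]
      by_cases hx : x ∈ Set.Icc 0 t
      · have hlt : x < t := lt_of_le_of_ne hx.2 hxt
        rw [Set.indicator_of_mem hx, Set.indicator_of_mem hx, ih hα' (sub_pos.2 hlt),
          ← ENNReal.ofReal_mul (Real.rpow_nonneg hx.1 _), ← ENNReal.ofReal_mul hG0]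
        congr 1
        ring
      · simp [Set.indicator_of_notMem hx]
    have hae : ∀ᵐ x : ℝ, x ≠ t := by simp [ae_iff]
    rw [← lintegral_indicator (measurableSet_scaledSimplex _ _)]
    change ∫⁻ x, F x = _
    rw [← hmp.lintegral_comp hF]
    change ∫⁻ p : ℝ × (Fin d → ℝ), F (e.symm p) = _
    rw [Measure.volume_eq_prod,
      lintegral_prod (fun p : ℝ × (Fin d → ℝ) => F (e.symm p)) (hF.comp e.symm.measurable).aemeasurable,
      lintegral_congr_ae (hae.mono hinner), lintegral_indicator measurableSet_Icc,
      lintegral_const_mul _ (by fun_prop), lintegral_beta_scaled (hα 0) (by linarith) ht,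
      ← ENNReal.ofReal_mul hG0, Fin.sum_univ_succ, Fin.prod_univ_succ]
    have hs : α 0 + A + β = α 0 + (A + β) := by ring
    rw [← hA, hs, hG, beta]
    congr 1
    field_simp

/-! ### Elementary facts about the simplex and the density. -/

lemma l1Norm_of_nonneg {d : ℕ} {x : Fin d → ℝ} (hx : ∀ i, 0 ≤ x i) : l1Norm x = ∑ i, x i :=
  Finset.sum_congr rfl fun i _ => abs_of_nonneg (hx i)

lemma simplex_eq_scaledSimplex (d : ℕ) : simplex d = scaledSimplex d 1 := by
  ext x
  constructor
  · rintro ⟨h1, h2⟩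
    exact ⟨fun i => (h1 i).1, by rwa [← l1Norm_of_nonneg fun i => (h1 i).1]⟩
  · rintro ⟨h1, h2⟩
    refine ⟨fun i => ⟨h1 i, ?_⟩, by rwa [l1Norm_of_nonneg h1]⟩
    exact (Finset.single_le_sum (fun j _ => h1 j) (Finset.mem_univ i)).trans h2

lemma measurableSet_simplex (d : ℕ) : MeasurableSet (simplex d) :=
  simplex_eq_scaledSimplex d ▸ measurableSet_scaledSimplex d 1

lemma simplex_nonneg {d : ℕ} {x : Fin d → ℝ} (hx : x ∈ simplex d) (i : Fin d) : 0 ≤ x i :=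
  (hx.1 i).1

lemma l1Norm_nonneg {d : ℕ} (x : Fin d → ℝ) : 0 ≤ l1Norm x :=
  Finset.sum_nonneg fun _ _ => abs_nonneg _

lemma simplexInt_subset_simplex (d : ℕ) : simplexInt d ⊆ simplex d :=
  fun _ hx => ⟨fun i => ⟨(hx.1 i).1.le, (hx.1 i).2.le⟩, hx.2.le⟩

@[fun_prop]
lemma continuous_l1Norm (d : ℕ) : Continuous (l1Norm : (Fin d → ℝ) → ℝ) := by
  unfold l1Norm; fun_prop

@[fun_prop]
lemma measurable_dirichletDensity {d : ℕ} (α : Fin d → ℝ) (β : ℝ) :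
    Measurable (dirichletDensity α β) := by
  have := (continuous_l1Norm d).measurable
  unfold dirichletDensity; fun_prop

/-! ### Normalisation and parameter shifts of the Dirichlet density. -/

section Density

variable {d : ℕ} {α : Fin d → ℝ} {β : ℝ}

lemma dirichletDensity_nonneg (hα : ∀ i, 0 < α i) (hβ : 0 < β) {x : Fin d → ℝ}
    (hx : x ∈ simplex d) : 0 ≤ dirichletDensity α β x := by
  have h1 : 0 ≤ 1 - l1Norm x := sub_nonneg.2 hx.2
  have h2 : 0 < l1Norm α + β := by linarith [l1Norm_nonneg α]
  exact mul_nonneg (div_nonneg (Real.Gamma_pos_of_pos h2).le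
    (mul_nonneg (Real.Gamma_pos_of_pos hβ).le
      (Finset.prod_nonneg fun i _ => (Real.Gamma_pos_of_pos (hα i)).le)))
    (mul_nonneg (Real.rpow_nonneg h1 _)
      (Finset.prod_nonneg fun i _ => Real.rpow_nonneg (simplex_nonneg hx i) _))

lemma lintegral_dirichletDensity (hα : ∀ i, 0 < α i) (hβ : 0 < β) :
    ∫⁻ x in simplex d, ENNReal.ofReal (dirichletDensity α β x) = 1 := by
  have hl : l1Norm α = ∑ i, α i := l1Norm_of_nonneg fun i => (hα i).le
  have h2 : 0 < l1Norm α + β := by linarith [l1Norm_nonneg α]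
  have hΓ := Real.Gamma_pos_of_pos h2
  have hβ' := Real.Gamma_pos_of_pos hβ
  have hp : 0 < ∏ i, Real.Gamma (α i) :=
    Finset.prod_pos fun i _ => Real.Gamma_pos_of_pos (hα i)
  have h3 : ∀ x ∈ simplex d, ENNReal.ofReal (dirichletDensity α β x) =
      ENNReal.ofReal (Real.Gamma (l1Norm α + β) / (Real.Gamma β * ∏ i, Real.Gamma (α i))) *
        ENNReal.ofReal ((1 - ∑ i, x i) ^ (β - 1) * ∏ i, x i ^ (α i - 1)) := by
    intro x hx
    rw [← ENNReal.ofReal_mul (by positivity), dirichletDensity,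
      l1Norm_of_nonneg (simplex_nonneg hx)]
  rw [setLIntegral_congr_fun (measurableSet_simplex d) h3, lintegral_const_mul _ (by fun_prop),
    simplex_eq_scaledSimplex, lintegral_dirichlet hα hβ one_pos,
    ← ENNReal.ofReal_mul (by positivity), hl, Real.one_rpow, mul_one]
  rw [hl] at hΓ
  rw [div_mul_div_comm, mul_comm, div_self (by positivity), ENNReal.ofReal_one]

lemma ae_dirichletDensity_nonneg (hα : ∀ i, 0 < α i) (hβ : 0 < β) :
    0 ≤ᵐ[volume.restrict (simplex d)] dirichletDensity α β :=
  (ae_restrict_iff' (measurableSet_simplex d)).2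
    (ae_of_all _ fun _ hx => dirichletDensity_nonneg hα hβ hx)

lemma integrableOn_dirichletDensity (hα : ∀ i, 0 < α i) (hβ : 0 < β) :
    IntegrableOn (dirichletDensity α β) (simplex d) := by
  refine ⟨by fun_prop, ?_⟩
  rw [hasFiniteIntegral_iff_ofReal (ae_dirichletDensity_nonneg hα hβ),
    lintegral_dirichletDensity hα hβ]
  exact ENNReal.one_lt_top

lemma integral_dirichletDensity (hα : ∀ i, 0 < α i) (hβ : 0 < β) :
    ∫ x in simplex d, dirichletDensity α β x = 1 := by
  rw [integral_eq_lintegral_of_nonneg_ae (ae_dirichletDensity_nonneg hα hβ) (by fun_prop),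
    lintegral_dirichletDensity hα hβ, ENNReal.toReal_one]

/-- Multiplying a Dirichlet density by a coordinate shifts the corresponding parameter. -/
lemma coord_mul_dirichletDensity (hα : ∀ i, 0 < α i) (hβ : 0 < β) (i : Fin d) {x : Fin d → ℝ}
    (hx : x ∈ simplex d) :
    dirichletDensity α β x * x i =
      α i / (l1Norm α + β) * dirichletDensity (α + Pi.single i 1) β x := by
  have h2 : 0 < l1Norm α + β := by linarith [l1Norm_nonneg α]
  have hα' : ∀ j, 0 < (α + Pi.single i 1 : Fin d → ℝ) j := fun j => by
    rw [Pi.add_apply, Pi.single_apply]; split_ifs <;> linarith [hα j]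
  have hl : l1Norm (α + Pi.single i 1) = l1Norm α + 1 := by
    rw [l1Norm_of_nonneg fun j => (hα' j).le, l1Norm_of_nonneg fun j => (hα j).le]
    simp [Finset.sum_add_distrib]
  have hprod : ∏ j, Real.Gamma ((α + Pi.single i 1 : Fin d → ℝ) j) = α i * ∏ j, Real.Gamma (α j) := by
    rw [← Finset.mul_prod_erase _ _ (Finset.mem_univ i),
      ← Finset.mul_prod_erase _ (fun j => Real.Gamma (α j)) (Finset.mem_univ i)]
    rw [Finset.prod_congr rfl (fun j hj => by
      rw [Pi.add_apply, Pi.single_eq_of_ne (Finset.ne_of_mem_erase hj), add_zero])]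
    rw [Pi.add_apply, Pi.single_eq_same, Real.Gamma_add_one (hα i).ne', mul_assoc]
  have hpow : ∏ j, x j ^ ((α + Pi.single i 1 : Fin d → ℝ) j - 1) = x i * ∏ j, x j ^ (α j - 1) := by
    rw [← Finset.mul_prod_erase _ _ (Finset.mem_univ i),
      ← Finset.mul_prod_erase _ (fun j => x j ^ (α j - 1)) (Finset.mem_univ i)]
    rw [Finset.prod_congr rfl (fun j hj => by
      rw [Pi.add_apply, Pi.single_eq_of_ne (Finset.ne_of_mem_erase hj), add_zero])]
    -- The power rule also holds at `x i = 0`, because the resulting exponent `α i` is nonzero.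
    rw [Pi.add_apply, Pi.single_eq_same, ← mul_assoc, mul_comm (x i),
      ← Real.rpow_add_one' (simplex_nonneg hx i) (by simpa using (hα i).ne')]
    congr 2; ring
  rw [dirichletDensity, dirichletDensity, hl, hprod, hpow,
    show l1Norm α + 1 + β = l1Norm α + β + 1 by ring, Real.Gamma_add_one h2.ne']
  have := hα i
  have hβ' := Real.Gamma_pos_of_pos hβ
  have hp : 0 < ∏ i, Real.Gamma (α i) :=
    Finset.prod_pos fun i _ => Real.Gamma_pos_of_pos (hα i)
  field_simp

end Density

/-! ### Second order Taylor expansion on the simplex. -/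

section Taylor

variable {d : ℕ}

lemma isCompact_simplex (d : ℕ) : IsCompact (simplex d) := by
  have h : simplex d = Set.Icc 0 1 ∩ {s | l1Norm s ≤ 1} := by
    ext x
    simp only [simplex, Set.mem_Icc, Set.mem_ofPred_eq, Set.mem_inter_iff, Pi.le_def, forall_and]
    rfl
  rw [h]
  exact isCompact_Icc.inter_right (isClosed_le (continuous_l1Norm d) continuous_const)

lemma convex_simplex (d : ℕ) : Convex ℝ (simplex d) := by
  rw [simplex_eq_scaledSimplex]
  intro x hx y hy a c ha hc hac
  refine ⟨fun i => ?_, ?_⟩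
  · have := hx.1 i
    have := hy.1 i
    simp only [Pi.add_apply, Pi.smul_apply, smul_eq_mul]
    positivity
  · simp only [Pi.add_apply, Pi.smul_apply, smul_eq_mul, Finset.sum_add_distrib, ← Finset.mul_sum]
    nlinarith [hx.2, hy.2]

lemma isOpen_simplexInt (d : ℕ) : IsOpen (simplexInt d) := by
  have h : simplexInt d = (⋂ i, {s | s i ∈ Set.Ioo (0 : ℝ) 1}) ∩ {s | l1Norm s < 1} := by
    ext x; simp [simplexInt]
  rw [h]
  exact (isOpen_iInter_of_finite fun i => isOpen_Ioo.preimage (continuous_apply i)).inter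
    (isOpen_lt (continuous_l1Norm d) continuous_const)

lemma simplexInt_nonempty (d : ℕ) : (simplexInt d).Nonempty := by
  have hd : (0 : ℝ) < d + 1 := by positivity
  have h0 : (0 : ℝ) < 1 / (d + 1) := by positivity
  refine ⟨fun _ => 1 / ((d : ℝ) + 1), fun i => ⟨h0, ?_⟩, ?_⟩
  · have : 0 < d := i.pos
    have : (0 : ℝ) < d := by exact_mod_cast this
    rw [div_lt_one hd]; linarith
  · rw [l1Norm_of_nonneg fun _ => h0.le]
    simp only [Finset.sum_const, Finset.card_univ, Fintype.card_fin, nsmul_eq_mul]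
    rw [mul_one_div, div_lt_one hd]; linarith

lemma uniqueDiffOn_simplex (d : ℕ) : UniqueDiffOn ℝ (simplex d) :=
  uniqueDiffOn_convex (convex_simplex d) ((simplexInt_nonempty d).mono
    (interior_maximal (simplexInt_subset_simplex d) (isOpen_simplexInt d)))

lemma simplex_mem_nhds {s : Fin d → ℝ} (hs : s ∈ simplexInt d) : simplex d ∈ 𝓝 s :=
  mem_of_superset ((isOpen_simplexInt d).mem_nhds hs) (simplexInt_subset_simplex d)

/-- A second order Taylor estimate on a convex set, from a bound on the oscillation of the second
derivative. -/
lemma norm_taylor_two_le {E : Type*} [NormedAddCommGroup E] [NormedSpace ℝ E] {f : E → ℝ}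
    {D : E → E →L[ℝ] ℝ} {D2 : E → E →L[ℝ] E →L[ℝ] ℝ} {S : Set E} (hS : Convex ℝ S) {s x : E}
    (hs : s ∈ S) (hx : x ∈ S) {c : ℝ}
    (hD : ∀ y ∈ S, HasFDerivWithinAt f (D y) S y)
    (hD2 : ∀ y ∈ S, HasFDerivWithinAt D (D2 y) S y)
    (hsymm : ∀ v w, D2 s v w = D2 s w v)
    (hc : ∀ y ∈ S, ‖y - s‖ ≤ ‖x - s‖ → ‖D2 y - D2 s‖ ≤ c) :
    |f x - f s - D s (x - s) - 1 / 2 * D2 s (x - s) (x - s)| ≤ c * ‖x - s‖ ^ 2 := by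
  set r := ‖x - s‖ with hr
  set T := S ∩ Metric.closedBall s r with hT
  have hTc : Convex ℝ T := hS.inter (convex_closedBall s r)
  have hsT : s ∈ T := ⟨hs, Metric.mem_closedBall_self (norm_nonneg _)⟩
  have hxT : x ∈ T := ⟨hx, by rw [mem_closedBall_iff_norm]⟩
  have hc0 : 0 ≤ c := (norm_nonneg (D2 s - D2 s)).trans (hc s hs (by simp [hr]))
  -- Mean value inequality for `D y - D2 s (y - s)`, whose derivative `D2 y - D2 s` is at most `c`
  -- on the ball. The same inequality applied to `f` minus its quadratic part then gives the claim.
  have h1 : ∀ y ∈ T, ‖D y - D s - D2 s (y - s)‖ ≤ c * r := by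
    intro y hy
    have := hTc.norm_image_sub_le_of_norm_hasFDerivWithin_le (f := fun y => D y - D2 s (y - s))
      (f' := fun y => D2 y - D2 s) (C := c) (x := s) (y := y)
      (fun z hz => ((hD2 z hz.1).mono Set.inter_subset_left).sub
        ((D2 s).hasFDerivAt.comp z ((hasFDerivAt_id z).sub_const s)).hasFDerivWithinAt)
      (fun z hz => hc z hz.1 (mem_closedBall_iff_norm.1 hz.2)) hsT hy
    simp only [sub_self, map_zero, sub_zero] at this
    calc ‖D y - D s - D2 s (y - s)‖ = ‖D y - D2 s (y - s) - D s‖ := by congr 1; abel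
      _ ≤ c * ‖y - s‖ := this
      _ ≤ c * r := mul_le_mul_of_nonneg_left (mem_closedBall_iff_norm.1 hy.2) hc0
  have h2 : ∀ y ∈ T, HasFDerivWithinAt
      (fun y => f y - D s (y - s) - 1 / 2 * D2 s (y - s) (y - s)) (D y - D s - D2 s (y - s)) T y := by
    intro y hy
    have hid : HasFDerivAt (fun y => y - s) (ContinuousLinearMap.id ℝ E) y :=
      (hasFDerivAt_id y).sub_const s
    have hq := (((D2 s).hasFDerivAt.comp y hid).clm_apply hid).const_mul (1 / 2 : ℝ)
    have := (((hD y hy.1).mono (Set.inter_subset_left : T ⊆ S)).sub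
      ((D s).hasFDerivAt.comp y hid).hasFDerivWithinAt).sub hq.hasFDerivWithinAt
    refine this.congr_fderiv ?_
    ext w
    simp
    -- Differentiating the quadratic form hits both slots; symmetry of `D2 s` merges the two halves.
    linear_combination (1 / 2) * hsymm w y - (1 / 2) * hsymm w s
  have h3 := hTc.norm_image_sub_le_of_norm_hasFDerivWithin_le h2 h1 hsT hxT
  simp only [sub_self, map_zero, mul_zero, sub_zero] at h3
  rw [← Real.norm_eq_abs]
  calc _ = ‖f x - D s (x - s) - 1 / 2 * D2 s (x - s) (x - s) - f s‖ := by congr 1; ring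
    _ ≤ c * r * r := h3
    _ = c * r ^ 2 := by ring

variable {f : (Fin d → ℝ) → ℝ}

/-- Nothing is known of `f` off the simplex, so derivatives are taken within it; they are continuous
up to the boundary, and compactness gives bounds uniform in `s`. -/
lemma fderivWithin_simplex_contDiffOn (hf : ContDiffOn ℝ 2 f (simplex d)) :
    ContDiffOn ℝ 1 (fderivWithin ℝ f (simplex d)) (simplex d) :=
  hf.fderivWithin (uniqueDiffOn_simplex d) (by norm_num)

/-- The Taylor remainder of order two on the simplex is uniformly small, up to a fourth power. -/
lemma taylor_simplex (hf : ContDiffOn ℝ 2 f (simplex d)) {ε : ℝ} (hε : 0 < ε) :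
    ∃ C, 0 ≤ C ∧ ∀ s ∈ simplexInt d, ∀ x ∈ simplex d,
      |f x - f s - fderiv ℝ f s (x - s) - 1 / 2 * fderiv ℝ (fderiv ℝ f) s (x - s) (x - s)| ≤
        ε * ‖x - s‖ ^ 2 + C * ‖x - s‖ ^ 4 := by
  set S := simplex d
  set D := fderivWithin ℝ f S with hDdef
  set D2 := fderivWithin ℝ D S with hD2def
  have hDc := fderivWithin_simplex_contDiffOn hf
  have hD : ∀ y ∈ S, HasFDerivWithinAt f (D y) S y := fun y hy =>
    (hf.differentiableOn (by norm_num) y hy).hasFDerivWithinAt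
  have hD2 : ∀ y ∈ S, HasFDerivWithinAt D (D2 y) S y := fun y hy =>
    (hDc.differentiableOn (by norm_num) y hy).hasFDerivWithinAt
  have hD2c : ContinuousOn D2 S := hDc.continuousOn_fderivWithin (uniqueDiffOn_simplex d) (by norm_num)
  obtain ⟨M, hM⟩ : ∃ M, ∀ y ∈ S, ‖D2 y‖ ≤ M :=
    (isCompact_simplex d).exists_bound_of_continuousOn
      (E := (Fin d → ℝ) →L[ℝ] (Fin d → ℝ) →L[ℝ] ℝ) hD2c
  have huc : UniformContinuousOn D2 S :=
    (isCompact_simplex d).uniformContinuousOn_of_continuous hD2c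
  obtain ⟨δ, hδ, hδ'⟩ := (Metric.uniformContinuousOn_iff (α := Fin d → ℝ)
    (β := (Fin d → ℝ) →L[ℝ] (Fin d → ℝ) →L[ℝ] ℝ)).1 huc ε hε
  have hM0 : 0 ≤ M := by
    obtain ⟨s, hs⟩ := simplexInt_nonempty d
    exact (norm_nonneg (D2 s)).trans (hM s (simplexInt_subset_simplex d hs))
  -- Within distance `δ` of `s` the oscillation of `D2` is below `ε`. Farther away it is at most `2
  -- * M`, and `‖x - s‖ ^ 2 ≤ ‖x - s‖ ^ 4 / δ ^ 2`.
  refine ⟨(M + M) / δ ^ 2, by positivity, fun s hs x hx => ?_⟩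
  have hsS := simplexInt_subset_simplex d hs
  have hev : D =ᶠ[𝓝 s] fderiv ℝ f := by
    filter_upwards [(isOpen_simplexInt d).mem_nhds hs] with y hy
    exact fderivWithin_of_mem_nhds (simplex_mem_nhds hy)
  have e1 : fderiv ℝ f s = D s := hev.self_of_nhds.symm
  have e2 : fderiv ℝ (fderiv ℝ f) s = D2 s := by
    rw [← hev.fderiv_eq, hD2def, fderivWithin_of_mem_nhds (simplex_mem_nhds hs)]
  have hsymm : ∀ v w, D2 s v w = D2 s w v := by
    have h : IsSymmSndFDerivAt ℝ f s :=
      (hf.contDiffAt (simplex_mem_nhds hs)).isSymmSndFDerivAt (by simp)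
    intro v w
    rw [← e2]
    exact h v w
  rw [e1, e2]
  by_cases hlt : ‖x - s‖ < δ
  · refine (norm_taylor_two_le (convex_simplex d) hsS hx hD hD2 hsymm (c := ε) ?_).trans
      (le_add_of_nonneg_right (by positivity))
    intro y hy hys
    exact (dist_eq_norm (D2 y) (D2 s)).symm.trans_le (hδ' y hy s hsS (by rw [dist_eq_norm]; linarith)).le
  · refine (norm_taylor_two_le (convex_simplex d) hsS hx hD hD2 hsymm (c := M + M)
      fun y hy _ => (norm_sub_le (D2 y) (D2 s)).trans (add_le_add (hM y hy) (hM s hsS))).trans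
      (le_add_of_nonneg_of_le (by positivity) ?_)
    rw [div_mul_eq_mul_div, le_div_iff₀ (by positivity), mul_assoc]
    refine mul_le_mul_of_nonneg_left ?_ (by positivity)
    have : δ ^ 2 ≤ ‖x - s‖ ^ 2 := pow_le_pow_left₀ hδ.le (not_lt.1 hlt) 2
    nlinarith [sq_nonneg ‖x - s‖]

lemma exists_bound_fderiv (hf : ContDiffOn ℝ 2 f (simplex d)) :
    ∃ M, 0 ≤ M ∧ ∀ s ∈ simplexInt d,
      ‖fderiv ℝ f s‖ ≤ M ∧ ‖fderiv ℝ (fderiv ℝ f) s‖ ≤ M := by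
  have hDc := fderivWithin_simplex_contDiffOn hf
  obtain ⟨M₁, h₁⟩ := (isCompact_simplex d).exists_bound_of_continuousOn hDc.continuousOn
  obtain ⟨M₂, h₂⟩ : ∃ M, ∀ y ∈ simplex d,
      ‖fderivWithin ℝ (fderivWithin ℝ f (simplex d)) (simplex d) y‖ ≤ M :=
    (isCompact_simplex d).exists_bound_of_continuousOn
    (hDc.continuousOn_fderivWithin (uniqueDiffOn_simplex d) (by norm_num))
  refine ⟨max 0 (max M₁ M₂), le_max_left _ _, fun s hs => ?_⟩
  have hsS := simplexInt_subset_simplex d hs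
  have hev : fderivWithin ℝ f (simplex d) =ᶠ[𝓝 s] fderiv ℝ f := by
    filter_upwards [(isOpen_simplexInt d).mem_nhds hs] with y hy
    exact fderivWithin_of_mem_nhds (simplex_mem_nhds hy)
  constructor
  · rw [← hev.self_of_nhds]
    exact (h₁ s hsS).trans (by simp)
  · rw [← hev.fderiv_eq, ← fderivWithin_of_mem_nhds (simplex_mem_nhds hs)]
    exact (h₂ s hsS).trans (by simp)

lemma gTerm_eq (hf : ContDiffOn ℝ 2 f (simplex d)) {s : Fin d → ℝ} (hs : s ∈ simplexInt d) :
    gTerm f s = ∑ i, (1 - ((d : ℝ) + 1) * s i) * fderiv ℝ f s (Pi.single i 1) +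
      (1 / 2) * ∑ i, ∑ j, s i * ((if i = j then 1 else 0) - s j) *
        fderiv ℝ (fderiv ℝ f) s (Pi.single i 1) (Pi.single j 1) := by
  have hd : DifferentiableAt ℝ (fderiv ℝ f) s :=
    ((hf.contDiffAt (simplex_mem_nhds hs)).fderiv_right (m := 1) (by norm_num)).differentiableAt
      (by norm_num)
  have h : ∀ i j, partialDeriv i (partialDeriv j f) s =
      fderiv ℝ (fderiv ℝ f) s (Pi.single i 1) (Pi.single j 1) := by
    intro i j
    unfold partialDeriv
    rw [fderiv_clm_apply hd (by fun_prop)]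
    simp
  simp only [gTerm, h]
  rfl

end Taylor

/-! ### Moments of the Dirichlet distribution. -/

noncomputable section

/-- The expectation of `h` under the Dirichlet distribution. -/
def dirichletMean {d : ℕ} (α : Fin d → ℝ) (β : ℝ) (h : (Fin d → ℝ) → ℝ) : ℝ :=
  ∫ x in simplex d, dirichletDensity α β x * h x

end

section Moments

variable {d : ℕ} {α : Fin d → ℝ} {β : ℝ} {g h : (Fin d → ℝ) → ℝ}

lemma integrableOn_dirichletDensity_mul (hα : ∀ i, 0 < α i) (hβ : 0 < β)
    (hh : ContinuousOn h (simplex d)) :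
    IntegrableOn (fun x => dirichletDensity α β x * h x) (simplex d) :=
  (integrableOn_dirichletDensity hα hβ).mul_continuousOn hh (isCompact_simplex d)

lemma dirichletMean_add (hα : ∀ i, 0 < α i) (hβ : 0 < β) (hg : ContinuousOn g (simplex d))
    (hh : ContinuousOn h (simplex d)) :
    dirichletMean α β (fun x => g x + h x) = dirichletMean α β g + dirichletMean α β h := by
  simp only [dirichletMean, mul_add]
  exact integral_add (integrableOn_dirichletDensity_mul hα hβ hg)
    (integrableOn_dirichletDensity_mul hα hβ hh)

lemma dirichletMean_const_mul (α : Fin d → ℝ) (β c : ℝ) (h : (Fin d → ℝ) → ℝ) :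
    dirichletMean α β (fun x => c * h x) = c * dirichletMean α β h := by
  simp only [dirichletMean, ← integral_const_mul]
  congr with x
  ring

lemma dirichletMean_const (hα : ∀ i, 0 < α i) (hβ : 0 < β) (c : ℝ) :
    dirichletMean α β (fun _ => c) = c := by
  simp only [dirichletMean, integral_mul_const, integral_dirichletDensity hα hβ, one_mul]

lemma dirichletMean_sum {ι : Type*} (t : Finset ι) {G : ι → (Fin d → ℝ) → ℝ} (hα : ∀ i, 0 < α i)
    (hβ : 0 < β) (hG : ∀ k, ContinuousOn (G k) (simplex d)) :
    dirichletMean α β (fun x => ∑ k ∈ t, G k x) = ∑ k ∈ t, dirichletMean α β (G k) := by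
  simp only [dirichletMean, Finset.mul_sum]
  exact integral_finsetSum _ fun k _ => integrableOn_dirichletDensity_mul hα hβ (hG k)

lemma dirichletMean_congr (hgh : Set.EqOn g h (simplex d)) :
    dirichletMean α β g = dirichletMean α β h :=
  setIntegral_congr_fun (measurableSet_simplex d) fun x hx => by simp only [hgh hx]

lemma abs_dirichletMean_le (hα : ∀ i, 0 < α i) (hβ : 0 < β)
    (hh : ContinuousOn h (simplex d)) (hgh : ∀ x ∈ simplex d, |g x| ≤ h x) :
    |dirichletMean α β g| ≤ dirichletMean α β h := by
  rw [← Real.norm_eq_abs]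
  refine norm_integral_le_of_norm_le (integrableOn_dirichletDensity_mul hα hβ hh) ?_
  refine (ae_restrict_iff' (measurableSet_simplex d)).2 (ae_of_all _ fun x hx => ?_)
  rw [norm_mul, Real.norm_of_nonneg (dirichletDensity_nonneg hα hβ hx), Real.norm_eq_abs]
  exact mul_le_mul_of_nonneg_left (hgh x hx) (dirichletDensity_nonneg hα hβ hx)

lemma shift_pos (hα : ∀ i, 0 < α i) (i j : Fin d) : 0 < (α + Pi.single i 1 : Fin d → ℝ) j := by
  rw [Pi.add_apply, Pi.single_apply]; split_ifs <;> linarith [hα j]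

lemma l1Norm_shift (hα : ∀ i, 0 < α i) (i : Fin d) :
    l1Norm (α + Pi.single i 1) = l1Norm α + 1 := by
  rw [l1Norm_of_nonneg fun j => (shift_pos hα i j).le, l1Norm_of_nonneg fun j => (hα j).le]
  simp [Finset.sum_add_distrib]

lemma dirichletMean_coord_mul (hα : ∀ i, 0 < α i) (hβ : 0 < β) (i : Fin d) :
    dirichletMean α β (fun x => x i * h x) =
      α i / (l1Norm α + β) * dirichletMean (α + Pi.single i 1) β h := by
  simp only [dirichletMean, ← integral_const_mul]
  refine setIntegral_congr_fun (measurableSet_simplex d) fun x hx => ?_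
  rw [← mul_assoc, coord_mul_dirichletDensity hα hβ i hx, mul_assoc]

/-- Each factor `x i` raises both `α i` and the total parameter by one, so the moment is a quotient
of rising factorials. -/
lemma dirichletMean_coord_pow (hα : ∀ i, 0 < α i) (hβ : 0 < β) (i : Fin d) (k : ℕ) :
    dirichletMean α β (fun x => x i ^ k) =
      ∏ j ∈ Finset.range k, (α i + j) / (l1Norm α + β + j) := by
  induction k generalizing α with
  | zero => simp [dirichletMean_const hα hβ]
  | succ k ih =>
    simp only [pow_succ']
    rw [dirichletMean_coord_mul hα hβ, ih (shift_pos hα i), Finset.prod_range_succ', mul_comm]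
    simp only [l1Norm_shift hα, Pi.add_apply, Pi.single_eq_same]
    push_cast
    congr 1
    · exact Finset.prod_congr rfl fun j _ => by congr 1 <;> ring
    · simp

lemma dirichletMean_coord (hα : ∀ i, 0 < α i) (hβ : 0 < β) (i : Fin d) :
    dirichletMean α β (fun x => x i) = α i / (l1Norm α + β) := by
  simpa using dirichletMean_coord_pow hα hβ i 1

lemma dirichletMean_coord_mul_coord (hα : ∀ i, 0 < α i) (hβ : 0 < β) (i j : Fin d) :
    dirichletMean α β (fun x => x i * x j) =
      α i / (l1Norm α + β) * ((α j + if i = j then 1 else 0) / (l1Norm α + β + 1)) := by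
  rw [dirichletMean_coord_mul hα hβ, dirichletMean_coord (shift_pos hα i) hβ, l1Norm_shift hα,
    Pi.add_apply, Pi.single_apply]
  simp only [eq_comm (a := j)]
  congr 2
  ring

end Moments

/-! ### Moments under the Dirichlet kernel, uniformly in `s`. -/

section KernelMoments

variable {d : ℕ} {s : Fin d → ℝ} {b : ℝ}

lemma kernel_alpha_pos (hs : s ∈ simplex d) (hb : 0 < b) (i : Fin d) : 0 < s i / b + 1 := by
  have := div_nonneg (simplex_nonneg hs i) hb.le
  linarith

lemma kernel_beta_pos (hs : s ∈ simplex d) (hb : 0 < b) : 0 < (1 - l1Norm s) / b + 1 := by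
  have := div_nonneg (sub_nonneg.2 hs.2) hb.le
  linarith

lemma kernel_total (hs : s ∈ simplex d) (hb : 0 < b) :
    l1Norm (fun i => s i / b + 1) + ((1 - l1Norm s) / b + 1) = 1 / b + (d + 1) := by
  rw [l1Norm_of_nonneg fun i => (kernel_alpha_pos hs hb i).le,
    l1Norm_of_nonneg (simplex_nonneg hs)]
  simp only [Finset.sum_add_distrib, ← Finset.sum_div]
  simp
  ring

/-- The expectation of `h` under the Dirichlet kernel. -/
noncomputable def kernelMean (b : ℝ) (s : Fin d → ℝ) (h : (Fin d → ℝ) → ℝ) : ℝ :=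
  dirichletMean (fun i => s i / b + 1) ((1 - l1Norm s) / b + 1) h

lemma kernelMean_eq (b : ℝ) (s : Fin d → ℝ) (h : (Fin d → ℝ) → ℝ) :
    kernelMean b s h = ∫ x in simplex d, kernel b s x * h x := rfl

/-- Clearing `1 / b` makes the moments rational functions of `b` that are regular at `b = 0`, with
denominators at least one. -/
lemma rescale_ratio (hb : 0 < b) (t : ℝ) {u : ℝ} (hu : 0 ≤ u) (k : ℝ) :
    (t / b + 1 + k) / (1 / b + u) = (t + (1 + k) * b) / (1 + u * b) := by
  have : 0 < 1 + u * b := by positivity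
  field_simp
  ring

lemma kernelMean_coord (hs : s ∈ simplex d) (hb : 0 < b) (i : Fin d) :
    kernelMean b s (fun x => x i) = (s i + b) / (1 + (d + 1) * b) := by
  rw [kernelMean, dirichletMean_coord (kernel_alpha_pos hs hb) (kernel_beta_pos hs hb),
    kernel_total hs hb]
  simpa using rescale_ratio hb (s i) (u := d + 1) (by positivity) 0

lemma kernelMean_coord_mul_coord (hs : s ∈ simplex d) (hb : 0 < b) (i j : Fin d) :
    kernelMean b s (fun x => x i * x j) = (s i + b) * (s j + (1 + if i = j then 1 else 0) * b) /
      ((1 + (d + 1) * b) * (1 + (d + 2) * b)) := by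
  rw [kernelMean, dirichletMean_coord_mul_coord (kernel_alpha_pos hs hb) (kernel_beta_pos hs hb),
    kernel_total hs hb, show (1 / b + ((d : ℝ) + 1) + 1) = 1 / b + (d + 2) by ring,
    rescale_ratio hb _ (by positivity), mul_div_mul_comm]
  simpa using Or.inl (rescale_ratio hb (s i) (u := d + 1) (by positivity) 0)

lemma kernelMean_coord_pow (hs : s ∈ simplex d) (hb : 0 < b) (i : Fin d) (k : ℕ) :
    kernelMean b s (fun x => x i ^ k) =
      ∏ j ∈ Finset.range k, (s i + (1 + j) * b) / (1 + (d + 1 + j) * b) := by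
  rw [kernelMean, dirichletMean_coord_pow (kernel_alpha_pos hs hb) (kernel_beta_pos hs hb),
    kernel_total hs hb]
  refine Finset.prod_congr rfl fun j _ => ?_
  rw [add_assoc (1 / b), rescale_ratio hb _ (by positivity)]

lemma kernelMean_sub_coord (hs : s ∈ simplex d) (hb : 0 < b) (i : Fin d) :
    kernelMean b s (fun x => x i - s i) = (s i + b) / (1 + (d + 1) * b) - s i := by
  simp only [sub_eq_add_neg]
  rw [← kernelMean_coord hs hb, kernelMean, kernelMean, dirichletMean_add (kernel_alpha_pos hs hb)
    (kernel_beta_pos hs hb) (by fun_prop) (by fun_prop),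
    dirichletMean_const (kernel_alpha_pos hs hb) (kernel_beta_pos hs hb)]

lemma kernelMean_sub_mul_sub (hs : s ∈ simplex d) (hb : 0 < b) (i j : Fin d) :
    kernelMean b s (fun x => (x i - s i) * (x j - s j)) =
      (s i + b) * (s j + (1 + if i = j then 1 else 0) * b) /
      ((1 + (d + 1) * b) * (1 + (d + 2) * b)) - s j * ((s i + b) / (1 + (d + 1) * b)) -
        s i * ((s j + b) / (1 + (d + 1) * b)) + s i * s j := by
  have hα := kernel_alpha_pos hs hb
  have hβ := kernel_beta_pos hs hb
  have h : (fun x : Fin d → ℝ => (x i - s i) * (x j - s j)) =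
      fun x => ((x i * x j + (-s j) * x i) + (-s i) * x j) + s i * s j := by
    ext x; ring
  rw [h, ← kernelMean_coord_mul_coord hs hb, ← kernelMean_coord hs hb, ← kernelMean_coord hs hb]
  unfold kernelMean
  rw [dirichletMean_add hα hβ (by fun_prop) (by fun_prop),
    dirichletMean_add hα hβ (by fun_prop) (by fun_prop),
    dirichletMean_add hα hβ (by fun_prop) (by fun_prop), dirichletMean_const_mul,
    dirichletMean_const_mul, dirichletMean_const hα hβ]
  ring

lemma kernelMean_sub_pow_four (hs : s ∈ simplex d) (hb : 0 < b) (i : Fin d) :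
    kernelMean b s (fun x => (x i - s i) ^ 4) =
      (∏ j ∈ Finset.range 4, (s i + (1 + j) * b) / (1 + (d + 1 + j) * b)) +
      (-4 * s i) * (∏ j ∈ Finset.range 3, (s i + (1 + j) * b) / (1 + (d + 1 + j) * b)) +
      (6 * s i ^ 2) * (∏ j ∈ Finset.range 2, (s i + (1 + j) * b) / (1 + (d + 1 + j) * b)) +
      (-4 * s i ^ 3) * ((s i + b) / (1 + (d + 1) * b)) + s i ^ 4 := by
  have hα := kernel_alpha_pos hs hb
  have hβ := kernel_beta_pos hs hb
  have h : (fun x : Fin d → ℝ => (x i - s i) ^ 4) = fun x => (((x i ^ 4 + (-4 * s i) * x i ^ 3) +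
      (6 * s i ^ 2) * x i ^ 2) + (-4 * s i ^ 3) * x i) + s i ^ 4 := by
    ext x; ring
  rw [h, ← kernelMean_coord hs hb, ← kernelMean_coord_pow hs hb, ← kernelMean_coord_pow hs hb,
    ← kernelMean_coord_pow hs hb]
  unfold kernelMean
  rw [dirichletMean_add hα hβ (by fun_prop) (by fun_prop),
    dirichletMean_add hα hβ (by fun_prop) (by fun_prop),
    dirichletMean_add hα hβ (by fun_prop) (by fun_prop),
    dirichletMean_add hα hβ (by fun_prop) (by fun_prop), dirichletMean_const_mul,
    dirichletMean_const_mul, dirichletMean_const_mul, dirichletMean_const hα hβ]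

/-- A quotient with denominator at least one is bounded by any bound on its numerator. -/
lemma abs_div_le_of_one_le {p q c : ℝ} (hq : 1 ≤ q) (hp : |p| ≤ c) : |p / q| ≤ c := by
  rw [abs_div, abs_of_pos (by linarith : 0 < q)]
  exact (div_le_self (abs_nonneg _) hq).trans hp

lemma exists_bound_kernelMean_sub (d : ℕ) : ∃ C, 0 ≤ C ∧ ∀ s ∈ simplex d, ∀ b, 0 < b → b ≤ 1 →
    ∀ i, |kernelMean b s (fun x => x i - s i) - b * (1 - (d + 1) * s i)| ≤ C * b ^ 2 := by
  refine ⟨(d + 1) * (1 + (d + 1)), by positivity, fun s hs b hb _ i => ?_⟩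
  have hden : 0 < 1 + ((d : ℝ) + 1) * b := by positivity
  have h1 := (hs.1 i).1
  have h2 := (hs.1 i).2
  have heq : kernelMean b s (fun x => x i - s i) - b * (1 - (d + 1) * s i) =
      -((d + 1) * (1 - (d + 1) * s i) * b ^ 2) / (1 + (d + 1) * b) := by
    rw [kernelMean_sub_coord hs hb, eq_div_iff hden.ne', sub_mul, sub_mul,
      div_mul_cancel₀ _ hden.ne']
    ring
  rw [heq]
  have hd : (0 : ℝ) ≤ d + 1 := by positivity
  refine abs_div_le_of_one_le (by nlinarith) ?_
  rw [abs_neg, abs_mul, abs_mul, abs_of_nonneg hd, abs_of_nonneg (sq_nonneg b)]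
  gcongr
  rw [abs_le]
  constructor <;> nlinarith

lemma exists_bound_kernelMean_sub_mul_sub (d : ℕ) : ∃ C, 0 ≤ C ∧ ∀ s ∈ simplex d, ∀ b, 0 < b →
    b ≤ 1 → ∀ i j, |kernelMean b s (fun x => (x i - s i) * (x j - s j)) -
      b * (s i * ((if i = j then 1 else 0) - s j))| ≤ C * b ^ 2 := by
  -- `Q` is what remains of the numerator of the error once `b ^ 2` is factored out; `e` stands for
  -- the Kronecker delta. All arguments lie in the unit cube, so compactness supplies the constant.
  let Q : ℝ × ℝ × ℝ × ℝ → ℝ := fun p =>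
    let D : ℝ := d + 1
    let u := p.1
    let v := p.2.1
    let e := p.2.2.1
    let b := p.2.2.2
    (1 + e) - (u + v) * (D + 1) + u * v * D * (D + 1) - (u * (e - v)) * (2 * D + 1 + D * (D + 1) * b)
  have hQ : Continuous Q := by fun_prop
  obtain ⟨C, hC⟩ := (isCompact_Icc (a := (0 : ℝ × ℝ × ℝ × ℝ)) (b := 1)).exists_bound_of_continuousOn
    hQ.continuousOn
  refine ⟨C, (norm_nonneg (Q 0)).trans (hC 0 (by simp)), fun s hs b hb hb1 i j => ?_⟩
  set e : ℝ := if i = j then 1 else 0 with he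
  have he0 : 0 ≤ e ∧ e ≤ 1 := by rw [he]; split_ifs <;> norm_num
  have hden : 0 < 1 + ((d : ℝ) + 1) * b := by positivity
  have hden2 : 0 < 1 + ((d : ℝ) + 2) * b := by positivity
  have heq : kernelMean b s (fun x => (x i - s i) * (x j - s j)) - b * (s i * (e - s j)) =
      (b ^ 2 * Q (s i, s j, e, b)) / ((1 + (d + 1) * b) * (1 + (d + 2) * b)) := by
    rw [kernelMean_sub_mul_sub hs hb, ← he]
    simp only [Q]
    field_simp
    ring
  rw [heq]
  refine abs_div_le_of_one_le ?_ ?_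
  · have h1 : 1 ≤ 1 + ((d : ℝ) + 1) * b := by linarith [mul_pos (by positivity : 0 < (d : ℝ) + 1) hb]
    have h2 : 1 ≤ 1 + ((d : ℝ) + 2) * b := by linarith [mul_pos (by positivity : 0 < (d : ℝ) + 2) hb]
    exact one_le_mul_of_one_le_of_one_le h1 h2
  · rw [abs_mul, abs_of_nonneg (sq_nonneg b), mul_comm]
    refine mul_le_mul_of_nonneg_right (hC _ ?_) (sq_nonneg b)
    simp only [Set.mem_Icc, Prod.le_def, Prod.fst_zero, Prod.snd_zero, Prod.fst_one, Prod.snd_one]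
    exact ⟨⟨(hs.1 i).1, (hs.1 j).1, he0.1, hb.le⟩, (hs.1 i).2, (hs.1 j).2, he0.2, hb1⟩

/-- Over the common denominator, the terms of order `1` and `b` in the fourth central moment cancel;
the numerator is `b ^ 2` times a polynomial, bounded on the unit square. -/
lemma exists_bound_kernelMean_sub_pow_four (d : ℕ) : ∃ C, 0 ≤ C ∧ ∀ s ∈ simplex d, ∀ b, 0 < b →
    b ≤ 1 → ∀ i, |kernelMean b s (fun x => (x i - s i) ^ 4)| ≤ C * b ^ 2 := by
  let Q : ℝ × ℝ → ℝ := fun p =>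
    let D : ℝ := d + 1
    let s := p.1
    let b := p.2
    24 * b ^ 2 + 26 * s * b - 72 * s * b ^ 2 - 24 * s * b ^ 2 * D + 3 * s ^ 2 - 72 * s ^ 2 * b
      - 20 * s ^ 2 * b * D + 72 * s ^ 2 * b ^ 2 + 60 * s ^ 2 * b ^ 2 * D
      + 12 * s ^ 2 * b ^ 2 * D ^ 2 - 6 * s ^ 3 + 64 * s ^ 3 * b + 42 * s ^ 3 * b * D
      + 6 * s ^ 3 * b * D ^ 2 - 24 * s ^ 3 * b ^ 2 - 44 * s ^ 3 * b ^ 2 * D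
      - 24 * s ^ 3 * b ^ 2 * D ^ 2 - 4 * s ^ 3 * b ^ 2 * D ^ 3 + 3 * s ^ 4 - 18 * s ^ 4 * b
      - 22 * s ^ 4 * b * D - 6 * s ^ 4 * b * D ^ 2 + 6 * s ^ 4 * b ^ 2 * D
      + 11 * s ^ 4 * b ^ 2 * D ^ 2 + 6 * s ^ 4 * b ^ 2 * D ^ 3 + s ^ 4 * b ^ 2 * D ^ 4
  have hQ : Continuous Q := by fun_prop
  obtain ⟨C, hC⟩ := (isCompact_Icc (a := (0 : ℝ × ℝ)) (b := 1)).exists_bound_of_continuousOn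
    hQ.continuousOn
  refine ⟨C, (norm_nonneg (Q 0)).trans (hC 0 (by simp)), fun s hs b hb hb1 i => ?_⟩
  have h1 : ∀ k : ℝ, 0 ≤ k → 1 ≤ 1 + ((d : ℝ) + 1 + k) * b := fun k hk => by
    linarith [mul_pos (by positivity : 0 < (d : ℝ) + 1 + k) hb]
  have h10 := h1 0 le_rfl
  have h11 := h1 1 zero_le_one
  have h12 := h1 2 zero_le_two
  have h13 := h1 3 (by norm_num)
  have heq : kernelMean b s (fun x => (x i - s i) ^ 4) = (b ^ 2 * Q (s i, b)) /
      ((1 + (d + 1 + 0) * b) * (1 + (d + 1 + 1) * b) * (1 + (d + 1 + 2) * b) *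
        (1 + (d + 1 + 3) * b)) := by
    have e0 : 1 + ((d : ℝ) + 1 + 0) * b ≠ 0 := by positivity
    have e1 : 1 + ((d : ℝ) + 1 + 1) * b ≠ 0 := by positivity
    have e2 : 1 + ((d : ℝ) + 1 + 2) * b ≠ 0 := by positivity
    have e3 : 1 + ((d : ℝ) + 1 + 3) * b ≠ 0 := by positivity
    rw [kernelMean_sub_pow_four hs hb]
    simp only [Q, Finset.prod_range_succ, Finset.prod_range_zero, one_mul, Nat.cast_zero,
      Nat.cast_one, Nat.cast_ofNat]
    rw [add_zero] at e0 ⊢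
    rw [add_zero]
    field_simp
    ring
  rw [heq]
  refine abs_div_le_of_one_le ?_ ?_
  · exact one_le_mul_of_one_le_of_one_le (one_le_mul_of_one_le_of_one_le
      (one_le_mul_of_one_le_of_one_le h10 h11) h12) h13
  · rw [abs_mul, abs_of_nonneg (sq_nonneg b), mul_comm]
    refine mul_le_mul_of_nonneg_right (hC _ ?_) (sq_nonneg b)
    simp only [Set.mem_Icc, Prod.le_def, Prod.fst_zero, Prod.snd_zero, Prod.fst_one, Prod.snd_one]
    exact ⟨⟨(hs.1 i).1, hb.le⟩, (hs.1 i).2, hb1⟩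

end KernelMoments

/-! ### Uniform expansion of the bias. -/

section Bias

variable {d : ℕ} {f : (Fin d → ℝ) → ℝ}

/-- The norm is the sup norm, attained at some coordinate. This bounds the Taylor remainder by
coordinate moments. -/
lemma norm_pow_le_sum_pow (v : Fin d → ℝ) {k : ℕ} (hk : Even k) (hk0 : k ≠ 0) :
    ‖v‖ ^ k ≤ ∑ i, v i ^ k := by
  rcases isEmpty_or_nonempty (Fin d) with h | h
  · simp [Subsingleton.elim v 0, hk0]
  · obtain ⟨i, hi⟩ := Finite.exists_max fun i => |v i|
    have hv : ‖v‖ ≤ |v i| := (pi_norm_le_iff_of_nonneg (abs_nonneg _)).2 hi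
    calc ‖v‖ ^ k ≤ |v i| ^ k := pow_le_pow_left₀ (norm_nonneg _) hv k
      _ = v i ^ k := hk.pow_abs _
      _ ≤ ∑ i, v i ^ k := Finset.single_le_sum (fun j _ => hk.pow_nonneg _) (Finset.mem_univ i)

lemma clm_apply_eq_sum {F : Type*} [NormedAddCommGroup F] [NormedSpace ℝ F]
    (L : (Fin d → ℝ) →L[ℝ] F) (v : Fin d → ℝ) : L v = ∑ i, v i • L (Pi.single i 1) := by
  conv_lhs => rw [pi_eq_sum_univ' v]
  simp

lemma norm_single_one (i : Fin d) : ‖(Pi.single i 1 : Fin d → ℝ)‖ = 1 := by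
  rw [Pi.norm_single, norm_one]

/-- The Taylor remainder of order two at `s`. -/
noncomputable def taylorRemainder (f : (Fin d → ℝ) → ℝ) (s x : Fin d → ℝ) : ℝ :=
  f x - f s - fderiv ℝ f s (x - s) - 1 / 2 * fderiv ℝ (fderiv ℝ f) s (x - s) (x - s)

lemma continuousOn_taylorRemainder (hf : ContinuousOn f (simplex d)) (s : Fin d → ℝ) :
    ContinuousOn (taylorRemainder f s) (simplex d) := by
  unfold taylorRemainder
  fun_prop

lemma taylor_expansion (f : (Fin d → ℝ) → ℝ) (s x : Fin d → ℝ) :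
    f x = ((f s + ∑ i, fderiv ℝ f s (Pi.single i 1) * (x i - s i)) +
      ∑ i, ∑ j, 1 / 2 * fderiv ℝ (fderiv ℝ f) s (Pi.single i 1) (Pi.single j 1) *
        ((x i - s i) * (x j - s j))) + taylorRemainder f s x := by
  have h1 : fderiv ℝ f s (x - s) = ∑ i, fderiv ℝ f s (Pi.single i 1) * (x i - s i) := by
    rw [clm_apply_eq_sum]
    exact Finset.sum_congr rfl fun i _ => by rw [smul_eq_mul, Pi.sub_apply, mul_comm]
  have h2 : 1 / 2 * fderiv ℝ (fderiv ℝ f) s (x - s) (x - s) =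
      ∑ i, ∑ j, 1 / 2 * fderiv ℝ (fderiv ℝ f) s (Pi.single i 1) (Pi.single j 1) *
        ((x i - s i) * (x j - s j)) := by
    rw [clm_apply_eq_sum (fderiv ℝ (fderiv ℝ f) s), _root_.sum_apply, Finset.mul_sum]
    refine Finset.sum_congr rfl fun i _ => ?_
    rw [_root_.smul_apply, clm_apply_eq_sum, smul_eq_mul, Finset.mul_sum,
      Finset.mul_sum]
    refine Finset.sum_congr rfl fun j _ => ?_
    simp only [smul_eq_mul, Pi.sub_apply]
    ring
  rw [taylorRemainder, ← h1, ← h2]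
  ring

lemma kernelMean_taylor (hf : ContinuousOn f (simplex d)) {s : Fin d → ℝ} (hs : s ∈ simplex d)
    {b : ℝ} (hb : 0 < b) :
    kernelMean b s f = ((f s + ∑ i, fderiv ℝ f s (Pi.single i 1) *
        kernelMean b s (fun x => x i - s i)) +
      ∑ i, ∑ j, 1 / 2 * fderiv ℝ (fderiv ℝ f) s (Pi.single i 1) (Pi.single j 1) *
        kernelMean b s (fun x => (x i - s i) * (x j - s j))) +
      kernelMean b s (taylorRemainder f s) := by
  have hα := kernel_alpha_pos hs hb
  have hβ := kernel_beta_pos hs hb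
  have hR := continuousOn_taylorRemainder hf s
  unfold kernelMean
  conv_lhs => rw [dirichletMean_congr (fun x _ => taylor_expansion f s x)]
  rw [dirichletMean_add hα hβ (by fun_prop) hR,
    dirichletMean_add hα hβ (by fun_prop) (by fun_prop),
    dirichletMean_add hα hβ (by fun_prop) (by fun_prop), dirichletMean_const hα hβ,
    dirichletMean_sum _ hα hβ (fun i => by fun_prop),
    dirichletMean_sum _ hα hβ (fun i => by fun_prop)]
  simp_rw [dirichletMean_const_mul]
  congr 2
  refine Finset.sum_congr rfl fun i _ => ?_
  rw [dirichletMean_sum _ hα hβ (fun j => by fun_prop)]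
  simp_rw [dirichletMean_const_mul]

lemma abs_kernelMean_taylorRemainder_le (hf : ContDiffOn ℝ 2 f (simplex d)) {ε : ℝ} (hε : 0 < ε) :
    ∃ C, 0 ≤ C ∧ ∀ s ∈ simplexInt d, ∀ b, 0 < b → b ≤ 1 →
      |kernelMean b s (taylorRemainder f s)| ≤ ε * b + C * b ^ 2 := by
  obtain ⟨C₂, hC₂0, hC₂⟩ := exists_bound_kernelMean_sub_mul_sub d
  obtain ⟨C₄, hC₄0, hC₄⟩ := exists_bound_kernelMean_sub_pow_four d
  -- The second moments sum to at most `d * (1 + C₂) * b`, so this `η` makes the quadratic part at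
  -- most `ε * b`; the `+ 1` keeps the denominator positive.
  set η : ℝ := ε / (d * (1 + C₂) + 1) with hη
  have hη0 : 0 < η := by positivity
  obtain ⟨C, hC0, hC⟩ := taylor_simplex hf hη0
  refine ⟨C * (d * C₄), by positivity, fun s hs b hb hb1 => ?_⟩
  have hsS := simplexInt_subset_simplex d hs
  have hα := kernel_alpha_pos hsS hb
  have hβ := kernel_beta_pos hsS hb
  have h1 : |kernelMean b s (taylorRemainder f s)| ≤
      kernelMean b s (fun x => η * ∑ i, (x i - s i) * (x i - s i) + C * ∑ i, (x i - s i) ^ 4) := by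
    refine abs_dirichletMean_le hα hβ (by fun_prop) fun x hx => (hC s hs x hx).trans ?_
    have h2 := norm_pow_le_sum_pow (x - s) (k := 2) (by decide) (by decide)
    have h4 := norm_pow_le_sum_pow (x - s) (k := 4) (by decide) (by decide)
    simp only [Pi.sub_apply, sq (_ - _)] at h2 h4
    exact add_le_add (mul_le_mul_of_nonneg_left (by simpa [sq] using h2) hη0.le)
      (mul_le_mul_of_nonneg_left h4 hC0)
  have h2 : ∀ i, kernelMean b s (fun x => (x i - s i) * (x i - s i)) ≤ (1 + C₂) * b := by
    intro i
    have h := (abs_le.1 (hC₂ s hsS b hb hb1 i i)).2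
    have := hsS.1 i
    simp only [if_true] at h
    have h3 : s i * (1 - s i) ≤ 1 := by nlinarith [this.1, this.2]
    nlinarith [mul_le_mul_of_nonneg_left h3 hb.le, mul_nonneg hC₂0 hb.le,
      mul_nonneg (mul_nonneg hC₂0 hb.le) (sub_nonneg.2 hb1)]
  have h4 : ∀ i, kernelMean b s (fun x => (x i - s i) ^ 4) ≤ C₄ * b ^ 2 := fun i =>
    (le_abs_self _).trans (hC₄ s hsS b hb hb1 i)
  unfold kernelMean at h1 h2 h4 ⊢
  rw [dirichletMean_add hα hβ (by fun_prop) (by fun_prop), dirichletMean_const_mul,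
    dirichletMean_const_mul, dirichletMean_sum _ hα hβ (fun i => by fun_prop),
    dirichletMean_sum _ hα hβ (fun i => by fun_prop)] at h1
  have h5 := Finset.sum_le_sum fun i (_ : i ∈ Finset.univ) => h2 i
  have h6 := Finset.sum_le_sum fun i (_ : i ∈ Finset.univ) => h4 i
  simp only [Finset.sum_const, Finset.card_univ, Fintype.card_fin, nsmul_eq_mul] at h5 h6
  refine h1.trans (add_le_add ?_ ?_)
  · calc _ ≤ η * (d * ((1 + C₂) * b)) := mul_le_mul_of_nonneg_left h5 hη0.le
      _ = η * (d * (1 + C₂)) * b := by ring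
      _ ≤ η * (d * (1 + C₂) + 1) * b := by gcongr; linarith
      _ = ε * b := by rw [hη, div_mul_cancel₀ _ (by positivity)]
  · calc _ ≤ C * (d * (C₄ * b ^ 2)) := mul_le_mul_of_nonneg_left h6 hC0
      _ = C * (d * C₄) * b ^ 2 := by ring

/-- The first order expansion of the bias, uniformly on the interior of the simplex. -/
lemma kernelMean_expansion (hf : ContDiffOn ℝ 2 f (simplex d)) {ε : ℝ} (hε : 0 < ε) :
    ∃ b₀, 0 < b₀ ∧ ∀ s ∈ simplexInt d, ∀ b, 0 < b → b < b₀ →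
      |kernelMean b s f - f s - b * gTerm f s| ≤ ε * b := by
  obtain ⟨C₁, hC₁0, hC₁⟩ := exists_bound_kernelMean_sub d
  obtain ⟨C₂, hC₂0, hC₂⟩ := exists_bound_kernelMean_sub_mul_sub d
  obtain ⟨C, hC0, hC⟩ := abs_kernelMean_taylorRemainder_le hf (half_pos hε)
  obtain ⟨M, hM0, hM⟩ := exists_bound_fderiv hf
  -- `K` collects all coefficients of `b ^ 2`; the choice of `b₀` makes `K * b ≤ ε / 2`, the Taylor
  -- remainder using the other half.
  set K : ℝ := d * (M * C₁) + d * (d * (1 / 2 * M * C₂)) + C with hK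
  have hK0 : 0 ≤ K := by positivity
  refine ⟨min 1 (ε / 2 / (K + 1)), by positivity, fun s hs b hb hb0 => ?_⟩
  have hb1 : b ≤ 1 := (hb0.trans_le (min_le_left _ _)).le
  have hbK : K * b ≤ ε / 2 := by
    have h := (hb0.trans_le (min_le_right _ _)).le
    rw [le_div_iff₀ (by positivity)] at h
    linarith
  have hsS := simplexInt_subset_simplex d hs
  have hL : ∀ i, |fderiv ℝ f s (Pi.single i 1)| ≤ M := fun i => by
    have := (fderiv ℝ f s).le_opNorm (Pi.single i 1)
    rw [norm_single_one, mul_one, Real.norm_eq_abs] at this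
    exact this.trans (hM s hs).1
  have hH : ∀ i j, |fderiv ℝ (fderiv ℝ f) s (Pi.single i 1) (Pi.single j 1)| ≤ M := fun i j => by
    have := (fderiv ℝ (fderiv ℝ f) s).le_opNorm₂ (Pi.single i 1) (Pi.single j 1)
    rw [norm_single_one, norm_single_one, mul_one, mul_one, Real.norm_eq_abs] at this
    exact this.trans (hM s hs).2
  have heq : kernelMean b s f - f s - b * gTerm f s =
      ∑ i, fderiv ℝ f s (Pi.single i 1) *
        (kernelMean b s (fun x => x i - s i) - b * (1 - (d + 1) * s i)) +
      ∑ i, ∑ j, 1 / 2 * fderiv ℝ (fderiv ℝ f) s (Pi.single i 1) (Pi.single j 1) *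
        (kernelMean b s (fun x => (x i - s i) * (x j - s j)) -
          b * (s i * ((if i = j then 1 else 0) - s j))) + kernelMean b s (taylorRemainder f s) := by
    rw [kernelMean_taylor hf.continuousOn hsS hb, gTerm_eq hf hs]
    simp only [mul_sub (fderiv ℝ f s _), mul_sub (1 / 2 * fderiv ℝ (fderiv ℝ f) s _ _),
      Finset.sum_sub_distrib]
    have e1 : b * ∑ i, (1 - ((d : ℝ) + 1) * s i) * fderiv ℝ f s (Pi.single i 1) =
        ∑ i, fderiv ℝ f s (Pi.single i 1) * (b * (1 - (d + 1) * s i)) := by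
      rw [Finset.mul_sum]
      exact Finset.sum_congr rfl fun i _ => by ring
    have e2 : b * ((1 / 2) * ∑ i, ∑ j, s i * ((if i = j then 1 else 0) - s j) *
          fderiv ℝ (fderiv ℝ f) s (Pi.single i 1) (Pi.single j 1)) =
        ∑ i, ∑ j, 1 / 2 * fderiv ℝ (fderiv ℝ f) s (Pi.single i 1) (Pi.single j 1) *
          (b * (s i * ((if i = j then 1 else 0) - s j))) := by
      simp only [Finset.mul_sum]
      exact Finset.sum_congr rfl fun i _ => Finset.sum_congr rfl fun j _ => by ring
    rw [mul_add b, e1, e2]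
    simp only [mul_sub, Finset.sum_sub_distrib]
    ring
  have hA : |∑ i, fderiv ℝ f s (Pi.single i 1) *
        (kernelMean b s (fun x => x i - s i) - b * (1 - (d + 1) * s i))| ≤
      d * (M * C₁) * b ^ 2 := by
    refine (Finset.abs_sum_le_sum_abs _ _).trans ?_
    refine (Finset.sum_le_sum fun i _ => (abs_mul _ _).trans_le
      (mul_le_mul (hL i) (hC₁ s hsS b hb hb1 i) (abs_nonneg _) hM0)).trans_eq ?_
    simp; ring
  have hB : |∑ i, ∑ j, 1 / 2 * fderiv ℝ (fderiv ℝ f) s (Pi.single i 1) (Pi.single j 1) *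
        (kernelMean b s (fun x => (x i - s i) * (x j - s j)) -
          b * (s i * ((if i = j then 1 else 0) - s j)))| ≤ d * (d * (1 / 2 * M * C₂)) * b ^ 2 := by
    refine (Finset.abs_sum_le_sum_abs _ _).trans ?_
    refine (Finset.sum_le_sum fun i _ => (Finset.abs_sum_le_sum_abs _ _).trans
      (Finset.sum_le_sum fun j _ => (abs_mul _ _).trans_le
        (mul_le_mul (b := 1 / 2 * M) ?_ (hC₂ s hsS b hb hb1 i j) (abs_nonneg _)
          (by positivity)))).trans_eq ?_
    · rw [abs_mul, abs_of_pos (by norm_num : (0 : ℝ) < 1 / 2)]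
      exact mul_le_mul_of_nonneg_left (hH i j) (by norm_num)
    · simp; ring
  rw [heq]
  refine (abs_add_three _ _ _).trans ?_
  have := hC s hs b hb hb1
  calc _ ≤ d * (M * C₁) * b ^ 2 + d * (d * (1 / 2 * M * C₂)) * b ^ 2 + (ε / 2 * b + C * b ^ 2) :=
        add_le_add (add_le_add hA hB) this
    _ = K * b * b + ε / 2 * b := by rw [hK]; ring
    _ ≤ ε / 2 * b + ε / 2 * b := by gcongr
    _ = ε * b := by ring

/-- Squaring the bias multiplies its error by a factor of the size of `gTerm`; this bound keeps the
squared error uniform in `s`. -/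
lemma exists_bound_gTerm (hf : ContDiffOn ℝ 2 f (simplex d)) :
    ∃ G, 0 ≤ G ∧ ∀ s ∈ simplexInt d, |gTerm f s| ≤ G := by
  obtain ⟨M, hM0, hM⟩ := exists_bound_fderiv hf
  refine ⟨d * ((1 + (d + 1)) * M) + 1 / 2 * (d * (d * (1 * M))), by positivity, fun s hs => ?_⟩
  have hsS := simplexInt_subset_simplex d hs
  have hL : ∀ i, |fderiv ℝ f s (Pi.single i 1)| ≤ M := fun i => by
    have := (fderiv ℝ f s).le_opNorm (Pi.single i 1)
    rw [norm_single_one, mul_one, Real.norm_eq_abs] at this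
    exact this.trans (hM s hs).1
  have hH : ∀ i j, |fderiv ℝ (fderiv ℝ f) s (Pi.single i 1) (Pi.single j 1)| ≤ M := fun i j => by
    have := (fderiv ℝ (fderiv ℝ f) s).le_opNorm₂ (Pi.single i 1) (Pi.single j 1)
    rw [norm_single_one, norm_single_one, mul_one, mul_one, Real.norm_eq_abs] at this
    exact this.trans (hM s hs).2
  rw [gTerm_eq hf hs]
  refine (abs_add_le _ _).trans (add_le_add ?_ ?_)
  · refine (Finset.abs_sum_le_sum_abs _ _).trans ?_
    refine (Finset.sum_le_sum fun i _ => (abs_mul _ _).trans_le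
      (mul_le_mul (b := 1 + ((d : ℝ) + 1)) ?_ (hL i) (abs_nonneg _) (by positivity))).trans_eq ?_
    · have h1 := (hsS.1 i).1
      have h2 := (hsS.1 i).2
      have hd : (0 : ℝ) ≤ d := by positivity
      rw [abs_le]; constructor <;> nlinarith
    · simp
  · rw [abs_mul, abs_of_pos (by norm_num : (0 : ℝ) < 1 / 2)]
    refine mul_le_mul_of_nonneg_left ?_ (by norm_num)
    refine (Finset.abs_sum_le_sum_abs _ _).trans ?_
    refine (Finset.sum_le_sum fun i _ => (Finset.abs_sum_le_sum_abs _ _).trans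
      (Finset.sum_le_sum fun j _ => (abs_mul _ _).trans_le
        (mul_le_mul (b := 1) ?_ (hH i j) (abs_nonneg _) zero_le_one))).trans_eq ?_
    · have h1 := hsS.1 i
      have h2 := hsS.1 j
      rw [abs_mul, abs_of_nonneg h1.1]
      refine mul_le_one₀ h1.2 (abs_nonneg _) ?_
      rw [abs_le]
      split_ifs <;> constructor <;> linarith [h2.1, h2.2]
    · simp

end Bias

/-! ### Gamma function asymptotics. -/

section GammaRatio

/-- The ratio `√x Γ(x + 1/2) / Γ(x + 1)`, which tends to one at infinity. -/
noncomputable def gammaRatio (x : ℝ) : ℝ := √x * Real.Gamma (x + 1 / 2) / Real.Gamma (x + 1)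

lemma gammaRatio_pos {x : ℝ} (hx : 0 < x) : 0 < gammaRatio x :=
  div_pos (mul_pos (Real.sqrt_pos.2 hx) (Real.Gamma_pos_of_pos (by linarith)))
    (Real.Gamma_pos_of_pos (by linarith))

/-- Log-convexity of the Gamma function between `y` and `y + 1`. -/
lemma Gamma_add_half_sq_le {y : ℝ} (hy : 0 < y) :
    Real.Gamma (y + 1 / 2) ^ 2 ≤ Real.Gamma y * Real.Gamma (y + 1) := by
  have h := Real.Gamma_mul_add_mul_le_rpow_Gamma_mul_rpow_Gamma hy (by linarith : 0 < y + 1)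
    (by norm_num : (0 : ℝ) < 1 / 2) (by norm_num : (0 : ℝ) < 1 / 2) (by norm_num)
  have h1 := (Real.Gamma_pos_of_pos hy).le
  have h2 := (Real.Gamma_pos_of_pos (by linarith : 0 < y + 1)).le
  rw [show 1 / 2 * y + 1 / 2 * (y + 1) = y + 1 / 2 by ring, ← Real.sqrt_eq_rpow,
    ← Real.sqrt_eq_rpow, ← Real.sqrt_mul h1] at h
  calc _ ≤ √(Real.Gamma y * Real.Gamma (y + 1)) ^ 2 :=
        pow_le_pow_left₀ (Real.Gamma_pos_of_pos (by linarith)).le h 2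
    _ = _ := Real.sq_sqrt (mul_nonneg h1 h2)

/-- Log-convexity at `x` and at `x + 1 / 2` gives `x / (x + 1 / 2) ≤ gammaRatio x ^ 2 ≤ 1`. -/
lemma abs_gammaRatio_sub_one_le {x : ℝ} (hx : 0 < x) : |gammaRatio x - 1| ≤ 1 / x := by
  have hp := gammaRatio_pos hx
  have h1 := Gamma_add_half_sq_le hx
  have h2 := Gamma_add_half_sq_le (by linarith : 0 < x + 1 / 2)
  rw [show x + 1 / 2 + 1 / 2 = x + 1 by ring, Real.Gamma_add_one (by linarith : x + 1 / 2 ≠ 0)] at h2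
  have hG0 := Real.Gamma_pos_of_pos hx
  have hG : 0 < Real.Gamma (x + 1 / 2) := Real.Gamma_pos_of_pos (by linarith)
  have hG1 : 0 < Real.Gamma (x + 1) := Real.Gamma_pos_of_pos (by linarith)
  have hsq : gammaRatio x ^ 2 = x * Real.Gamma (x + 1 / 2) ^ 2 / Real.Gamma (x + 1) ^ 2 := by
    rw [gammaRatio, div_pow, mul_pow, Real.sq_sqrt hx.le]
  have hle : gammaRatio x ^ 2 ≤ 1 := by
    rw [hsq, div_le_one (by positivity)]
    calc _ ≤ x * (Real.Gamma x * Real.Gamma (x + 1)) := by gcongr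
      _ = Real.Gamma (x + 1) ^ 2 := by rw [Real.Gamma_add_one hx.ne']; ring
  have hge : x ≤ gammaRatio x ^ 2 * (x + 1 / 2) := by
    rw [hsq, div_mul_eq_mul_div, le_div_iff₀ (by positivity)]
    calc _ ≤ x * (Real.Gamma (x + 1 / 2) * ((x + 1 / 2) * Real.Gamma (x + 1 / 2))) := by gcongr
      _ = _ := by ring
  have hle1 : gammaRatio x ≤ 1 := by nlinarith
  rw [abs_sub_comm, abs_of_nonneg (by linarith), le_div_iff₀ hx]
  nlinarith

/-- The duplication formula in terms of `gammaRatio`. -/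
lemma Gamma_two_mul_add_one {x : ℝ} (hx : 0 < x) :
    Real.Gamma (2 * x + 1) =
      4 ^ x * gammaRatio x / (√Real.pi * √x) * Real.Gamma (x + 1) ^ 2 := by
  -- Duplication is applied at `x + 1 / 2`, so that the doubled argument is `2 * x + 1`.
  have h := Real.Gamma_mul_Gamma_add_half (x + 1 / 2)
  rw [show x + 1 / 2 + 1 / 2 = x + 1 by ring, show 2 * (x + 1 / 2) = 2 * x + 1 by ring,
    show 1 - (2 * x + 1) = -(2 * x) by ring, Real.rpow_neg (by norm_num),
    Real.rpow_mul (by norm_num)] at h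
  norm_num at h
  have hG1 : 0 < Real.Gamma (x + 1) := Real.Gamma_pos_of_pos (by linarith)
  have h4 : (0 : ℝ) < 4 ^ x := by positivity
  have hs : 0 < √x := Real.sqrt_pos.2 hx
  have hpi : 0 < √Real.pi := Real.sqrt_pos.2 Real.pi_pos
  have h' : Real.Gamma (2 * x + 1) * √Real.pi =
      4 ^ x * (Real.Gamma (x + 1 / 2) * Real.Gamma (x + 1)) := by
    norm_num
    rw [h]
    field_simp
  rw [gammaRatio]
  generalize Real.Gamma (x + 1 / 2) = G at *
  field_simp
  linear_combination h'

lemma Gamma_add_natCast_add_one {x : ℝ} (hx : 0 < x) (d : ℕ) :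
    Real.Gamma (x + (d + 1)) = (∏ j ∈ Finset.range d, (x + (j + 1))) * Real.Gamma (x + 1) := by
  induction d with
  | zero => simp
  | succ d ih =>
    rw [Finset.prod_range_succ, mul_right_comm, ← ih, ← add_assoc,
      Real.Gamma_add_one (by positivity)]
    push_cast
    ring

end GammaRatio

/-! ### Calculus of factors `1 + O(b)`. -/

section NearOne

/-- `F * G - 1 = F * (G - 1) + (F - 1)`, with `F` bounded near zero. -/
lemma isBigO_mul_sub_one {F G : ℝ → ℝ} (hF : (fun b => F b - 1) =O[𝓝[>] 0] fun b : ℝ => b)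
    (hG : (fun b => G b - 1) =O[𝓝[>] 0] fun b : ℝ => b) :
    (fun b => F b * G b - 1) =O[𝓝[>] 0] fun b : ℝ => b := by
  have h0 : (fun b : ℝ => b) =O[𝓝[>] 0] fun _ => (1 : ℝ) :=
    (tendsto_nhdsWithin_of_tendsto_nhds tendsto_id).isBigO_one ℝ
  have hF1 : F =O[𝓝[>] 0] fun _ => (1 : ℝ) := by
    simpa using (hF.trans h0).add (isBigO_refl (fun _ : ℝ => (1 : ℝ)) _)
  have h := (hF1.mul hG).add (by simpa using hF : (fun b => F b - 1) =O[𝓝[>] 0] fun b : ℝ => 1 * b)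
  refine (h.congr (fun b => ?_) (fun b => one_mul b))
  ring

lemma isBigO_prod_sub_one {ι : Type*} (t : Finset ι) {F : ι → ℝ → ℝ}
    (hF : ∀ i ∈ t, (fun b => F i b - 1) =O[𝓝[>] 0] fun b : ℝ => b) :
    (fun b => ∏ i ∈ t, F i b - 1) =O[𝓝[>] 0] fun b : ℝ => b := by
  classical
  induction t using Finset.induction_on with
  | empty => simpa using isBigO_zero _ _
  | insert i t hi ih =>
    simp only [Finset.prod_insert hi]
    exact isBigO_mul_sub_one (hF i (by simp)) (ih fun j hj => hF j (by simp [hj]))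

lemma isBigO_inv_sub_one {F : ℝ → ℝ} (hF : (fun b => F b - 1) =O[𝓝[>] 0] fun b : ℝ => b) :
    (fun b => (F b)⁻¹ - 1) =O[𝓝[>] 0] fun b : ℝ => b := by
  have hlim : Tendsto (fun b => F b - 1) (𝓝[>] 0) (𝓝 0) :=
    hF.trans_tendsto (tendsto_nhdsWithin_of_tendsto_nhds tendsto_id)
  have hlim' : Tendsto F (𝓝[>] 0) (𝓝 1) := by simpa using hlim.add_const 1
  have hinv := (hlim'.inv₀ one_ne_zero).isBigO_one ℝ
  refine ((hinv.mul hF.neg_left).congr' ?_ (Eventually.of_forall fun b => one_mul b))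
  filter_upwards [hlim'.eventually_ne one_ne_zero] with b hb
  field_simp
  ring

lemma isBigO_one_add_mul_sub_one (c : ℝ) :
    (fun b => (1 + c * b) - 1) =O[𝓝[>] 0] fun b : ℝ => b := by
  simpa using isBigO_const_mul_self c (fun b : ℝ => b) (𝓝[>] 0)

lemma isBigO_gammaRatio_sub_one {c : ℝ} (hc : 0 < c) :
    (fun b => gammaRatio (c / b) - 1) =O[𝓝[>] 0] fun b : ℝ => b := by
  refine IsBigO.of_bound (1 / c) ?_
  filter_upwards [self_mem_nhdsWithin] with b hb
  have hb : 0 < b := hb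
  rw [Real.norm_eq_abs, Real.norm_of_nonneg hb.le]
  refine (abs_gammaRatio_sub_one_le (div_pos hc hb)).trans_eq ?_
  field_simp

end NearOne

/-! ### Second moment of the kernel. -/

section KernelSquare

variable {d : ℕ} {f : (Fin d → ℝ) → ℝ} {s : Fin d → ℝ} {b : ℝ}

/-- The normalising constant of the Dirichlet kernel. -/
noncomputable def kernelConst (b : ℝ) (s : Fin d → ℝ) : ℝ :=
  Real.Gamma (1 / b + (d + 1)) /
    (Real.Gamma ((1 - l1Norm s) / b + 1) * ∏ i, Real.Gamma (s i / b + 1))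

lemma kernel_eq (hs : s ∈ simplex d) (hb : 0 < b) (x : Fin d → ℝ) :
    kernel b s x = kernelConst b s * ((1 - l1Norm x) ^ ((1 - l1Norm s) / b) *
      ∏ i, x i ^ (s i / b)) := by
  simp only [kernel, dirichletDensity, kernel_total hs hb, kernelConst, add_sub_cancel_right]

lemma kernelConst_pos (hs : s ∈ simplex d) (hb : 0 < b) : 0 < kernelConst b s :=
  div_pos (Real.Gamma_pos_of_pos (by positivity))
    (mul_pos (Real.Gamma_pos_of_pos (kernel_beta_pos hs hb))
      (Finset.prod_pos fun i _ => Real.Gamma_pos_of_pos (kernel_alpha_pos hs hb i)))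

/-- The exponents are exactly `s i / b` and `(1 - ‖s‖₁) / b`, so squaring doubles them, which
amounts to halving `b`. -/
lemma kernel_sq (hs : s ∈ simplex d) (hb : 0 < b) {x : Fin d → ℝ} (hx : x ∈ simplex d) :
    kernel b s x ^ 2 = kernelConst b s ^ 2 / kernelConst (b / 2) s * kernel (b / 2) s x := by
  have hpow : ∀ y t : ℝ, 0 ≤ y → (y ^ (t / b)) ^ 2 = y ^ (t / (b / 2)) := fun y t hy => by
    rw [← Real.rpow_natCast, ← Real.rpow_mul hy]
    congr 1
    field_simp
    norm_num
  have hC := kernelConst_pos hs (half_pos hb)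
  rw [kernel_eq hs hb, kernel_eq hs (half_pos hb), mul_pow, mul_pow, ← Finset.prod_pow,
    hpow _ _ (sub_nonneg.2 hx.2), Finset.prod_congr rfl fun i _ => hpow _ _ (simplex_nonneg hx i)]
  field_simp

/-- The relative error in the asymptotics of the `L²` norm of the Dirichlet kernel. -/
noncomputable def kernelSqError (s : Fin d → ℝ) (b : ℝ) : ℝ :=
  (∏ j ∈ Finset.range d, (1 + (j + 1) * b) * (1 + (j + 1) * b) * (1 + (j + 1) / 2 * b)⁻¹) *
    (gammaRatio ((1 - l1Norm s) / b) * (∏ i, gammaRatio (s i / b)) * (gammaRatio (1 / b))⁻¹)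

lemma one_sub_l1Norm_pos (hs : s ∈ simplexInt d) : 0 < 1 - l1Norm s := sub_pos.2 hs.2

/-- Every factor is `1 + O(b)`. The bounds used for the Gamma ratios have constants `1 / s i` and `1
/ (1 - ‖s‖₁)`, so this argument is pointwise in `s`. -/
lemma isBigO_kernelSqError (hs : s ∈ simplexInt d) :
    (fun b => kernelSqError s b - 1) =O[𝓝[>] 0] fun b : ℝ => b := by
  refine isBigO_mul_sub_one (isBigO_prod_sub_one _ fun j _ => ?_)
    (isBigO_mul_sub_one (isBigO_mul_sub_one
      (isBigO_gammaRatio_sub_one (one_sub_l1Norm_pos hs))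
      (isBigO_prod_sub_one _ fun i _ => isBigO_gammaRatio_sub_one (hs.1 i).1))
      (isBigO_inv_sub_one (isBigO_gammaRatio_sub_one one_pos)))
  exact isBigO_mul_sub_one (isBigO_mul_sub_one (isBigO_one_add_mul_sub_one _)
    (isBigO_one_add_mul_sub_one _)) (isBigO_inv_sub_one (isBigO_one_add_mul_sub_one _))

lemma psi_eq (hs : s ∈ simplexInt d) :
    psi s = ((2 * √Real.pi) ^ d * √(1 - l1Norm s) * ∏ i, √(s i))⁻¹ := by
  have hw := one_sub_l1Norm_pos hs
  have hp : 0 < ∏ i, s i := Finset.prod_pos fun i _ => (hs.1 i).1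
  have hpi := Real.pi_pos
  rw [psi, Real.rpow_neg (by positivity), ← Real.sqrt_eq_rpow]
  congr 1
  rw [Real.sqrt_eq_iff_mul_self_eq_of_pos]
  · rw [← Real.sq_sqrt hw.le, ← Finset.prod_congr rfl fun i _ => Real.sq_sqrt (hs.1 i).1.le,
      Finset.prod_pow, show (4 * Real.pi) ^ d = ((2 * √Real.pi) ^ d) ^ 2 by
        rw [← pow_mul, mul_comm d 2, pow_mul, mul_pow 2 (√Real.pi) 2, Real.sq_sqrt hpi.le]; norm_num]
    simp only [Real.sqrt_sq (Real.sqrt_nonneg _)]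
    ring
  · have : 0 < ∏ i, √(s i) := Finset.prod_pos fun i _ => Real.sqrt_pos.2 (hs.1 i).1
    have := Real.sqrt_pos.2 hw
    positivity

lemma psi_pos (hs : s ∈ simplexInt d) : 0 < psi s := by
  have := one_sub_l1Norm_pos hs
  have : 0 < ∏ i, s i := Finset.prod_pos fun i _ => (hs.1 i).1
  have := Real.pi_pos
  unfold psi
  positivity

/-- Duplication expresses each Gamma value at bandwidth `b / 2` through the square of the one at
`b`, and these squares cancel. The powers of `4` cancel since the `s i` and `1 - ‖s‖₁` sum to one.
The square roots, with `P₁ ^ 2 / P₂ ≈ (1 / (2 * b)) ^ d`, leave `b ^ (-d / 2) * psi s`. -/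
lemma kernelConst_sq_div (hs : s ∈ simplexInt d) (hb : 0 < b) :
    kernelConst b s ^ 2 / kernelConst (b / 2) s =
      b ^ (-(d : ℝ) / 2) * psi s * kernelSqError s b := by
  have hw := one_sub_l1Norm_pos hs
  set w := 1 - l1Norm s with hwdef
  have hN : 0 < 1 / b := by positivity
  have hsN : ∀ i, 0 < s i / b := fun i => div_pos (hs.1 i).1 hb
  have hwN : 0 < w / b := div_pos hw hb
  set P₁ : ℝ := ∏ j ∈ Finset.range d, (1 / b + (j + 1)) with hP₁
  set P₂ : ℝ := ∏ j ∈ Finset.range d, (2 * (1 / b) + (j + 1)) with hP₂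
  have hfour : (4 : ℝ) ^ (w / b) * ∏ i, (4 : ℝ) ^ (s i / b) = 4 ^ (1 / b) := by
    rw [← Real.rpow_sum_of_pos (by norm_num : (0 : ℝ) < 4), ← Real.rpow_add (by norm_num),
      ← Finset.sum_div, ← add_div, hwdef,
      l1Norm_of_nonneg (simplex_nonneg (simplexInt_subset_simplex d hs)), sub_add_cancel]
  have hq : b ^ (-(d : ℝ) / 2) = √(1 / b) ^ d := by
    rw [Real.sqrt_eq_rpow, ← Real.rpow_natCast, ← Real.rpow_mul hN.le, one_div,
      Real.inv_rpow hb.le, ← Real.rpow_neg hb.le]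
    congr 1
    ring
  have hsqrt : ∀ t, 0 < t → √(t / b) = √t * √(1 / b) := fun t ht => by
    rw [← Real.sqrt_mul ht.le, mul_one_div]
  have hPerr : P₁ ^ 2 / P₂ = (√(1 / b) ^ 2 / 2) ^ d *
      ∏ j ∈ Finset.range d, (1 + (j + 1) * b) * (1 + (j + 1) * b) * (1 + (j + 1) / 2 * b)⁻¹ := by
    rw [Real.sq_sqrt hN.le, hP₁, hP₂, ← Finset.prod_pow, ← Finset.prod_div_distrib]
    conv_rhs => rw [← Finset.card_range d, ← Finset.prod_const, Finset.card_range]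
    rw [← Finset.prod_mul_distrib]
    refine Finset.prod_congr rfl fun j _ => ?_
    field_simp
  have e1 : kernelConst b s = P₁ * Real.Gamma (1 / b + 1) /
      (Real.Gamma (w / b + 1) * ∏ i, Real.Gamma (s i / b + 1)) := by
    rw [kernelConst, Gamma_add_natCast_add_one hN]
  have htwo : ∀ t, t / (b / 2) = 2 * (t / b) := fun t => by field_simp
  have e2 : kernelConst (b / 2) s = P₂ * (4 ^ (1 / b) * gammaRatio (1 / b) /
        (√Real.pi * √(1 / b)) * Real.Gamma (1 / b + 1) ^ 2) /
      ((4 ^ (w / b) * gammaRatio (w / b) / (√Real.pi * (√w * √(1 / b))) *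
        Real.Gamma (w / b + 1) ^ 2) *
      ((∏ i, (4 : ℝ) ^ (s i / b)) * (∏ i, gammaRatio (s i / b)) /
        (√Real.pi ^ d * ((∏ i, √(s i)) * √(1 / b) ^ d)) *
        (∏ i, Real.Gamma (s i / b + 1)) ^ 2)) := by
    rw [kernelConst, ← hwdef, htwo 1, htwo w, Gamma_add_natCast_add_one (by positivity),
      Gamma_two_mul_add_one hN, Gamma_two_mul_add_one hwN, hsqrt w hw]
    simp only [htwo, Gamma_two_mul_add_one (hsN _), Finset.prod_mul_distrib,
      Finset.prod_div_distrib, Finset.prod_pow, hsqrt _ (hs.1 _).1, Finset.prod_const,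
      Finset.card_univ, Fintype.card_fin]
    rw [hP₂]
  have hP₁0 : 0 < P₁ := Finset.prod_pos fun j _ => by positivity
  have hP₂0 : 0 < P₂ := Finset.prod_pos fun j _ => by positivity
  have hG1 := gammaRatio_pos hN
  have hGw := gammaRatio_pos hwN
  have hGs : 0 < ∏ i, gammaRatio (s i / b) := Finset.prod_pos fun i _ => gammaRatio_pos (hsN i)
  have hΓ1 : 0 < Real.Gamma (1 / b + 1) := Real.Gamma_pos_of_pos (by positivity)
  have hΓw : 0 < Real.Gamma (w / b + 1) := Real.Gamma_pos_of_pos (by positivity)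
  have hΓs : 0 < ∏ i, Real.Gamma (s i / b + 1) :=
    Finset.prod_pos fun i _ => Real.Gamma_pos_of_pos (by linarith [hsN i])
  have h4s : 0 < ∏ i, (4 : ℝ) ^ (s i / b) := Finset.prod_pos fun i _ => by positivity
  have h4w : (0 : ℝ) < 4 ^ (w / b) := by positivity
  have hss : 0 < ∏ i, √(s i) := Finset.prod_pos fun i _ => Real.sqrt_pos.2 (hs.1 i).1
  have hws : 0 < √w := Real.sqrt_pos.2 hw
  have hNs : 0 < √(1 / b) := Real.sqrt_pos.2 hN
  have hps : 0 < √Real.pi := Real.sqrt_pos.2 Real.pi_pos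
  have hsplit : kernelConst b s ^ 2 / kernelConst (b / 2) s =
      P₁ ^ 2 / P₂ * (gammaRatio (w / b) * (∏ i, gammaRatio (s i / b)) * (gammaRatio (1 / b))⁻¹) /
        (√Real.pi ^ d * √w * (∏ i, √(s i)) * √(1 / b) ^ d) := by
    rw [e1, e2, ← hfour]
    generalize (4 : ℝ) ^ (w / b) = x₁ at *
    generalize ∏ i, (4 : ℝ) ^ (s i / b) = x₂ at *
    generalize gammaRatio (1 / b) = x₃ at *
    generalize gammaRatio (w / b) = x₄ at *
    generalize ∏ i, gammaRatio (s i / b) = x₅ at *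
    generalize Real.Gamma (1 / b + 1) = x₆ at *
    generalize Real.Gamma (w / b + 1) = x₇ at *
    generalize ∏ i, Real.Gamma (s i / b + 1) = x₈ at *
    generalize √(1 / b) = x₉ at *
    field_simp
  rw [hsplit, hPerr, kernelSqError, psi_eq hs, hq, ← hwdef, div_pow, mul_pow]
  generalize √(1 / b) = q at *
  generalize ∏ j ∈ Finset.range d,
    (1 + ((j : ℝ) + 1) * b) * (1 + (j + 1) * b) * (1 + (j + 1) / 2 * b)⁻¹ = W
  rw [← pow_mul, mul_comm 2 d, pow_mul]
  field_simp

lemma integral_kernel_sq_mul (hs : s ∈ simplexInt d) (hb : 0 < b) :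
    ∫ x in simplex d, kernel b s x ^ 2 * f x =
      b ^ (-(d : ℝ) / 2) * psi s * kernelSqError s b * kernelMean (b / 2) s f := by
  have hsS := simplexInt_subset_simplex d hs
  rw [← kernelConst_sq_div hs hb, kernelMean_eq, ← integral_const_mul]
  refine setIntegral_congr_fun (measurableSet_simplex d) fun x hx => ?_
  simp only [kernel_sq hsS hb hx, mul_assoc]

lemma isBigO_kernelMean_sub (hf : ContDiffOn ℝ 2 f (simplex d)) (hs : s ∈ simplexInt d) :
    (fun b => kernelMean b s f - f s) =O[𝓝[>] 0] fun b : ℝ => b := by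
  obtain ⟨b₀, hb₀, h⟩ := kernelMean_expansion hf one_pos
  refine IsBigO.of_bound (1 + |gTerm f s|) ?_
  filter_upwards [Ioo_mem_nhdsGT hb₀] with b hb
  have h1 := h s hs b hb.1 hb.2
  rw [Real.norm_eq_abs, Real.norm_of_nonneg hb.1.le]
  calc |kernelMean b s f - f s| =
      |(kernelMean b s f - f s - b * gTerm f s) + b * gTerm f s| := by rw [sub_add_cancel]
    _ ≤ 1 * b + b * |gTerm f s| := (abs_add_le _ _).trans
        (add_le_add h1 (by rw [abs_mul, abs_of_pos hb.1]))
    _ = (1 + |gTerm f s|) * b := by ring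

lemma isBigO_integral_kernel_sq (hf : ContDiffOn ℝ 2 f (simplex d)) (hs : s ∈ simplexInt d) :
    (fun b => (∫ x in simplex d, kernel b s x ^ 2 * f x) - b ^ (-(d : ℝ) / 2) * (psi s * f s))
      =O[𝓝[>] 0] fun b : ℝ => b ^ (-(d : ℝ) / 2 + 1 / 2) := by
  have hhalf : Tendsto (fun b : ℝ => b / 2) (𝓝[>] 0) (𝓝[>] 0) := by
    refine tendsto_nhdsWithin_iff.2 ⟨?_, ?_⟩
    · have : Tendsto (fun b : ℝ => b / 2) (𝓝 0) (𝓝 (0 / 2)) := tendsto_id.div_const 2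
      rw [zero_div] at this
      exact tendsto_nhdsWithin_of_tendsto_nhds this
    · filter_upwards [self_mem_nhdsWithin] with b hb
      exact half_pos (Set.mem_Ioi.1 hb)
  have h0 : (fun b : ℝ => b) =O[𝓝[>] 0] fun _ => (1 : ℝ) :=
    (tendsto_nhdsWithin_of_tendsto_nhds tendsto_id).isBigO_one ℝ
  have hK : (fun b => kernelMean (b / 2) s f - f s) =O[𝓝[>] 0] fun b : ℝ => b :=
    ((isBigO_kernelMean_sub hf hs).comp_tendsto hhalf).trans
      (by simpa [div_eq_inv_mul, Function.comp_def] using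
        isBigO_const_mul_self (2⁻¹ : ℝ) (fun b : ℝ => b) (𝓝[>] 0))
  have hK1 : (fun b => kernelMean (b / 2) s f) =O[𝓝[>] 0] fun _ => (1 : ℝ) := by
    simpa using (hK.trans h0).add (isBigO_const_const (f s) one_ne_zero _)
  have hU : (fun b => kernelSqError s b * kernelMean (b / 2) s f - f s) =O[𝓝[>] 0]
      fun b : ℝ => b := by
    have h1 : (fun b => (kernelSqError s b - 1) * kernelMean (b / 2) s f) =O[𝓝[>] 0]
        fun b : ℝ => b := by
      simpa using (isBigO_kernelSqError hs).mul hK1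
    exact (h1.add hK).congr_left fun b => by ring
  -- The relative error is in fact `O(b)`; it is weakened to the stated rate `b ^ (1 / 2)`.
  have hroot : (fun b : ℝ => b) =O[𝓝[>] 0] fun b : ℝ => b ^ (1 / 2 : ℝ) := by
    refine IsBigO.of_bound 1 ?_
    filter_upwards [Ioo_mem_nhdsGT one_pos] with b hb
    rw [one_mul, Real.norm_of_nonneg hb.1.le, Real.norm_of_nonneg (Real.rpow_nonneg hb.1.le _)]
    simpa using Real.rpow_le_rpow_of_exponent_ge hb.1 hb.2.le (by norm_num : (1 / 2 : ℝ) ≤ 1)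
  have hmain := (((isBigO_refl (fun b : ℝ => b ^ (-(d : ℝ) / 2)) (𝓝[>] 0)).mul
    (hU.trans hroot)).const_mul_left (psi s))
  refine hmain.congr' ?_ ?_
  · filter_upwards [self_mem_nhdsWithin] with b hb
    rw [integral_kernel_sq_mul hs hb]
    ring
  · filter_upwards [self_mem_nhdsWithin] with b hb
    rw [Real.rpow_add hb]

end KernelSquare

/-! ### From samples to integrals: mean, variance and MSE of the estimator. -/

section Sampling

variable {d n : ℕ} {f : (Fin d → ℝ) → ℝ} {s : Fin d → ℝ} {b : ℝ}

@[fun_prop]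
lemma measurable_kernel (b : ℝ) (s : Fin d → ℝ) : Measurable (kernel b s) :=
  measurable_dirichletDensity _ _

lemma integral_simplexLaw (hf : IsSimplexDensity f) (h : (Fin d → ℝ) → ℝ) :
    ∫ x, h x ∂(simplexLaw f) = ∫ x in simplex d, h x * f x := by
  rw [simplexLaw, integral_withDensity_eq_integral_toReal_smul₀
    hf.integrableOn.aemeasurable.ennreal_ofReal (ae_of_all _ fun _ => ENNReal.ofReal_lt_top)]
  refine setIntegral_congr_fun (measurableSet_simplex d) fun x hx => ?_
  simp only [ENNReal.toReal_ofReal (hf.nonneg x hx), smul_eq_mul, mul_comm]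

lemma ae_simplexLaw_mem (f : (Fin d → ℝ) → ℝ) : ∀ᵐ x ∂(simplexLaw f), x ∈ simplex d :=
  (withDensity_absolutelyContinuous _ _).ae_le (ae_restrict_mem (measurableSet_simplex d))

/-- The shift by `+ 1` in the parameters makes all exponents nonnegative, so the kernel is bounded
on the simplex; square integrability follows. -/
lemma abs_kernel_le (hs : s ∈ simplex d) (hb : 0 < b) {x : Fin d → ℝ} (hx : x ∈ simplex d) :
    |kernel b s x| ≤ kernelConst b s := by
  have hx1 : 0 ≤ 1 - l1Norm x := sub_nonneg.2 hx.2
  have hC := (kernelConst_pos hs hb).le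
  rw [kernel_eq hs hb, abs_of_nonneg (mul_nonneg hC (mul_nonneg (Real.rpow_nonneg hx1 _)
    (Finset.prod_nonneg fun i _ => Real.rpow_nonneg (simplex_nonneg hx i) _)))]
  refine mul_le_of_le_one_right hC (mul_le_one₀ ?_
    (Finset.prod_nonneg fun i _ => Real.rpow_nonneg (simplex_nonneg hx i) _)
    (Finset.prod_le_one (fun i _ => Real.rpow_nonneg (simplex_nonneg hx i) _) fun i _ => ?_))
  · exact Real.rpow_le_one hx1 (by linarith [l1Norm_nonneg x])
      (div_nonneg (sub_nonneg.2 hs.2) hb.le)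
  · exact Real.rpow_le_one (hx.1 i).1 (hx.1 i).2 (div_nonneg (simplex_nonneg hs i) hb.le)

lemma integral_abs_sub_sq {Ω : Type*} [MeasurableSpace Ω] {P : Measure Ω} [IsProbabilityMeasure P]
    {Y : Ω → ℝ} (hY : MemLp Y 2 P) (c : ℝ) :
    ∫ ω, |Y ω - c| ^ 2 ∂P = variance Y P + ((∫ ω, Y ω ∂P) - c) ^ 2 := by
  have h1 : Integrable Y P := hY.integrable one_le_two
  have h := variance_eq_sub (X := fun ω => Y ω - c) (hY.sub (memLp_const c))
  rw [variance_sub_const hY.1] at h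
  rw [h]
  simp only [sq_abs, Pi.pow_apply]
  rw [integral_sub h1 (integrable_const c)]
  simp

variable {Ω : Type*} [MeasurableSpace Ω] {P : Measure Ω} {X : Fin n → Ω → (Fin d → ℝ)}

lemma integral_comp_sample (hf : IsSimplexDensity f) (hX : IsSample P f X)
    {h : (Fin d → ℝ) → ℝ} (hh : Measurable h) (i : Fin n) :
    ∫ ω, h (X i ω) ∂P = ∫ x in simplex d, h x * f x :=
  ((hX.hasLaw i).integral_comp hh.aestronglyMeasurable).trans (integral_simplexLaw hf h)

variable [IsProbabilityMeasure P]

lemma memLp_kernel_comp (hX : IsSample P f X) (hs : s ∈ simplex d) (hb : 0 < b) (i : Fin n) :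
    MemLp (fun ω => kernel b s (X i ω)) 2 P := by
  have hlaw := hX.hasLaw i
  have : IsProbabilityMeasure (simplexLaw f) := hlaw.isProbabilityMeasure_iff.1 inferInstance
  have h : MemLp (kernel b s) 2 (simplexLaw f) :=
    MemLp.of_bound (measurable_kernel b s).aestronglyMeasurable (kernelConst b s)
      ((ae_simplexLaw_mem f).mono fun x hx => abs_kernel_le hs hb hx)
  rw [← hlaw.map_eq] at h
  exact h.comp_of_map hlaw.aemeasurable

lemma memLp_estimator (hX : IsSample P f X) (hs : s ∈ simplex d) (hb : 0 < b) :
    MemLp (estimator X b s) 2 P :=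
  (memLp_finsetSum _ fun i _ => memLp_kernel_comp hX hs hb i).const_mul _

lemma integral_estimator (hn : 0 < n) (hf : IsSimplexDensity f) (hX : IsSample P f X)
    (hs : s ∈ simplex d) (hb : 0 < b) :
    ∫ ω, estimator X b s ω ∂P = kernelMean b s f := by
  have hn' : (n : ℝ) ≠ 0 := by positivity
  simp only [estimator]
  rw [integral_const_mul, integral_finsetSum _ fun i _ =>
    (memLp_kernel_comp hX hs hb i).integrable one_le_two]
  simp only [integral_comp_sample hf hX (measurable_kernel b s), ← kernelMean_eq]
  simp [hn']

lemma variance_estimator (hn : 0 < n) (hf : IsSimplexDensity f) (hX : IsSample P f X)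
    (hs : s ∈ simplex d) (hb : 0 < b) :
    variance (estimator X b s) P = (n : ℝ)⁻¹ *
      ((∫ x in simplex d, kernel b s x ^ 2 * f x) - kernelMean b s f ^ 2) := by
  have hn' : (n : ℝ) ≠ 0 := by positivity
  have hvar : ∀ i, variance (fun ω => kernel b s (X i ω)) P =
      (∫ x in simplex d, kernel b s x ^ 2 * f x) - kernelMean b s f ^ 2 := by
    intro i
    rw [variance_eq_sub (memLp_kernel_comp hX hs hb i)]
    simp only [Pi.pow_apply]
    rw [integral_comp_sample hf hX (measurable_kernel b s),
      integral_comp_sample hf hX (h := fun x => kernel b s x ^ 2) (by fun_prop), kernelMean_eq]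
  have hsum : variance (∑ i, fun ω => kernel b s (X i ω)) P =
      ∑ i, variance (fun ω => kernel b s (X i ω)) P := by
    refine IndepFun.variance_sum (fun i _ => memLp_kernel_comp hX hs hb i) fun i _ j _ hij => ?_
    exact (hX.indep.indepFun hij).comp (measurable_kernel b s) (measurable_kernel b s)
  have hest : estimator X b s = fun ω => 1 / (n : ℝ) * (∑ i, fun ω => kernel b s (X i ω)) ω := by
    ext ω
    simp [estimator]
  rw [hest, variance_const_mul, hsum]
  simp only [hvar, Finset.sum_const, Finset.card_univ, Fintype.card_fin, nsmul_eq_mul]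
  field_simp

/-- The mean squared error as a function of the sample size and the density. -/
noncomputable def mseOf (f : (Fin d → ℝ) → ℝ) (s : Fin d → ℝ) (n : ℕ) (b : ℝ) : ℝ :=
  (n : ℝ)⁻¹ * ((∫ x in simplex d, kernel b s x ^ 2 * f x) - kernelMean b s f ^ 2) +
    (kernelMean b s f - f s) ^ 2

lemma meanSquaredError_eq_variance_add (hX : IsSample P f X) (hs : s ∈ simplex d) (hb : 0 < b) :
    meanSquaredError P f X b s = variance (estimator X b s) P + bias P f X b s ^ 2 :=
  integral_abs_sub_sq (memLp_estimator hX hs hb) _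

lemma meanSquaredError_eq_mseOf (hn : 0 < n) (hf : IsSimplexDensity f) (hX : IsSample P f X)
    (hs : s ∈ simplex d) (hb : 0 < b) :
    meanSquaredError P f X b s = mseOf f s n b := by
  rw [meanSquaredError_eq_variance_add hX hs hb, bias, integral_estimator hn hf hX hs hb,
    variance_estimator hn hf hX hs hb, mseOf]

end Sampling

/-! ### The two remainders of the MSE. -/

section Remainders

variable {d : ℕ} {f : (Fin d → ℝ) → ℝ} {s : Fin d → ℝ}

/-- The remainder of the variance. -/
noncomputable def varianceRemainder (f : (Fin d → ℝ) → ℝ) (s : Fin d → ℝ) (p : ℕ × ℝ) : ℝ :=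
  (p.1 : ℝ)⁻¹ * ((∫ x in simplex d, kernel p.2 s x ^ 2 * f x) -
    p.2 ^ (-(d : ℝ) / 2) * (psi s * f s) - kernelMean p.2 s f ^ 2)

/-- The remainder of the squared bias. -/
noncomputable def sqBiasRemainder (f : (Fin d → ℝ) → ℝ) (s : Fin d → ℝ) (p : ℕ × ℝ) : ℝ :=
  (kernelMean p.2 s f - f s) ^ 2 - p.2 ^ 2 * gTerm f s ^ 2

lemma mseOf_eq (f : (Fin d → ℝ) → ℝ) (s : Fin d → ℝ) (n : ℕ) (b : ℝ) :
    mseOf f s n b = (n : ℝ)⁻¹ * b ^ (-(d : ℝ) / 2) * (psi s * f s) + b ^ 2 * gTerm f s ^ 2 +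
      varianceRemainder f s (n, b) + sqBiasRemainder f s (n, b) := by
  simp only [mseOf, varianceRemainder, sqBiasRemainder]
  ring

lemma isBigO_varianceRemainder (hd : 0 < d) (hf : ContDiffOn ℝ 2 f (simplex d))
    (hs : s ∈ simplexInt d) :
    varianceRemainder f s =O[atTop ×ˢ 𝓝[>] (0 : ℝ)]
      fun p => (p.1 : ℝ)⁻¹ * p.2 ^ (-(d : ℝ) / 2 + 1 / 2) := by
  have h0 : (fun b : ℝ => b) =O[𝓝[>] 0] fun _ => (1 : ℝ) :=
    (tendsto_nhdsWithin_of_tendsto_nhds tendsto_id).isBigO_one ℝ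
  have hd1 : (1 : ℝ) ≤ d := by exact_mod_cast hd
  -- The subtracted squared mean is only bounded; it is absorbed because `d ≥ 1` makes the exponent
  -- `-d / 2 + 1 / 2` nonpositive.
  have hone : (fun _ : ℝ => (1 : ℝ)) =O[𝓝[>] 0] fun b : ℝ => b ^ (-(d : ℝ) / 2 + 1 / 2) := by
    refine IsBigO.of_bound 1 ?_
    filter_upwards [Ioo_mem_nhdsGT one_pos] with b hb
    rw [one_mul, norm_one, Real.norm_of_nonneg (Real.rpow_nonneg hb.1.le _)]
    exact Real.one_le_rpow_of_pos_of_le_one_of_nonpos hb.1 hb.2.le (by linarith)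
  have hK1 : (fun b => kernelMean b s f) =O[𝓝[>] 0] fun _ => (1 : ℝ) := by
    simpa using ((isBigO_kernelMean_sub hf hs).trans h0).add
      (isBigO_const_const (f s) one_ne_zero _)
  have hK2 : (fun b => kernelMean b s f ^ 2) =O[𝓝[>] 0] fun b : ℝ => b ^ (-(d : ℝ) / 2 + 1 / 2) :=
    IsBigO.trans (by simpa using hK1.pow 2) hone
  have h := ((isBigO_integral_kernel_sq hf hs).sub hK2).comp_tendsto
    (tendsto_snd (f := (atTop : Filter ℕ)) (g := 𝓝[>] (0 : ℝ)))
  exact (isBigO_refl (fun p : ℕ × ℝ => (p.1 : ℝ)⁻¹) _).mul h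

lemma sqBiasRemainder_le (hf : ContDiffOn ℝ 2 f (simplex d)) {ε : ℝ} (hε : 0 < ε) :
    ∀ᶠ p : ℕ × ℝ in atTop ×ˢ 𝓝[>] (0 : ℝ),
      ∀ s ∈ simplexInt d, |sqBiasRemainder f s p| ≤ ε * p.2 ^ 2 := by
  obtain ⟨G, hG0, hG⟩ := exists_bound_gTerm hf
  -- The remainder is a difference of two squares, bounded by `η * b` times `b * (1 + 2 * G)`; hence
  -- `η * (1 + 2 * G) ≤ ε`, while `η ≤ 1` serves the second factor.
  set η : ℝ := min 1 (ε / (1 + 2 * G)) with hη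
  have hη0 : 0 < η := by positivity
  obtain ⟨b₀, hb₀, h⟩ := kernelMean_expansion hf hη0
  have hmem : ∀ᶠ b : ℝ in 𝓝[>] 0, b ∈ Set.Ioo 0 b₀ := Ioo_mem_nhdsGT hb₀
  filter_upwards [(tendsto_snd (f := (atTop : Filter ℕ)) (g := 𝓝[>] (0 : ℝ))).eventually hmem]
    with p hp s hs
  obtain ⟨hb, hb'⟩ := hp
  set b := p.2
  have h1 := h s hs b hb hb'
  have hg := hG s hs
  have h2 : |kernelMean b s f - f s + b * gTerm f s| ≤ b * (1 + 2 * G) := by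
    calc _ = |(kernelMean b s f - f s - b * gTerm f s) + 2 * (b * gTerm f s)| := by
          congr 1; ring
      _ ≤ η * b + 2 * (b * G) := by
          refine (abs_add_le _ _).trans (add_le_add h1 ?_)
          rw [abs_mul, abs_mul, abs_of_pos hb, abs_two]
          gcongr
      _ ≤ 1 * b + 2 * (b * G) := by gcongr; exact min_le_left _ _
      _ = _ := by ring
  calc |sqBiasRemainder f s p| =
      |kernelMean b s f - f s - b * gTerm f s| * |kernelMean b s f - f s + b * gTerm f s| := by
        rw [← abs_mul, sqBiasRemainder]; congr 1; ring
    _ ≤ η * b * (b * (1 + 2 * G)) := mul_le_mul h1 h2 (abs_nonneg _) (by positivity)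
    _ = η * (1 + 2 * G) * b ^ 2 := by ring
    _ ≤ ε * b ^ 2 := by
        have := (le_div_iff₀ (by positivity : 0 < 1 + 2 * G)).1 (min_le_right 1 (ε / (1 + 2 * G)))
        gcongr

lemma isLittleO_sqBiasRemainder (hf : ContDiffOn ℝ 2 f (simplex d)) (hs : s ∈ simplexInt d) :
    sqBiasRemainder f s =o[atTop ×ˢ 𝓝[>] (0 : ℝ)] fun p : ℕ × ℝ => p.2 ^ 2 := by
  refine isLittleO_iff.2 fun ε hε => ?_
  filter_upwards [sqBiasRemainder_le hf hε] with p hp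
  rw [Real.norm_eq_abs, Real.norm_of_nonneg (sq_nonneg _)]
  exact hp s hs

end Remainders

/-! ### Critical and optimal bandwidths. -/

section Bandwidth

/-- The leading part of a mean squared error in dimension `D`. -/
noncomputable def leading (D A G : ℝ) (n : ℕ) (b : ℝ) : ℝ :=
  (n : ℝ)⁻¹ * b ^ (-D / 2) * A + b ^ 2 * G

variable {D A G : ℝ}

/-- The exponent `2 / (D + 4)` is the one for which variance and squared bias carry the same power
of `n`; compare `rescale_sq`. -/
lemma rescale_variance (hD : 0 < D) {n : ℕ} (hn : 0 < n) {b : ℝ} (hb : 0 < b) :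
    (n : ℝ)⁻¹ * b ^ (-D / 2) =
      (n : ℝ) ^ (-4 / (D + 4)) * ((n : ℝ) ^ (2 / (D + 4)) * b) ^ (-D / 2) := by
  have hn' : (0 : ℝ) < n := by exact_mod_cast hn
  rw [Real.mul_rpow (by positivity) hb.le, ← Real.rpow_mul hn'.le, ← mul_assoc,
    ← Real.rpow_add hn', ← Real.rpow_neg_one]
  congr 2
  field_simp
  ring

lemma rescale_sq (hD : 0 < D) {n : ℕ} (hn : 0 < n) (b : ℝ) :
    b ^ 2 = (n : ℝ) ^ (-4 / (D + 4)) * ((n : ℝ) ^ (2 / (D + 4)) * b) ^ 2 := by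
  have hn' : (0 : ℝ) < n := by exact_mod_cast hn
  rw [mul_pow, ← Real.rpow_natCast ((n : ℝ) ^ (2 / (D + 4))), ← Real.rpow_mul hn'.le, ← mul_assoc,
    ← Real.rpow_add hn']
  rw [show -4 / (D + 4) + 2 / (D + 4) * ((2 : ℕ) : ℝ) = 0 by push_cast; field_simp; ring,
    Real.rpow_zero, one_mul]

/-- A bandwidth of the critical order tends to zero. -/
lemma tendsto_bandwidth (hD : 0 < D) {b : ℕ → ℝ} {lam : ℝ} (hb : ∀ᶠ n in atTop, 0 < b n)
    (h : Tendsto (fun n : ℕ => (n : ℝ) ^ (2 / (D + 4)) * b n) atTop (𝓝 lam)) :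
    Tendsto (fun n => (n, b n)) atTop (atTop ×ˢ 𝓝[>] (0 : ℝ)) := by
  refine tendsto_id.prodMk (tendsto_nhdsWithin_iff.2 ⟨?_, hb⟩)
  have h1 : Tendsto (fun n : ℕ => (n : ℝ) ^ (-(2 / (D + 4)))) atTop (𝓝 0) :=
    (tendsto_rpow_neg_atTop (by positivity)).comp tendsto_natCast_atTop_atTop
  have h2 := h1.mul h
  rw [zero_mul] at h2
  refine h2.congr' ?_
  filter_upwards [eventually_gt_atTop 0] with n hn
  have hn' : (0 : ℝ) < n := by exact_mod_cast hn
  rw [← mul_assoc, ← Real.rpow_add hn', neg_add_cancel, Real.rpow_zero, one_mul]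

lemma isLittleO_mul_of_tendsto_zero {r w : ℕ → ℝ} (hw : Tendsto w atTop (𝓝 0)) :
    (fun n => r n * w n) =o[atTop] r := by
  simpa using (isBigO_refl r atTop).mul_isLittleO ((isLittleO_one_iff ℝ).2 hw)

variable {m : ℕ → ℝ → ℝ} {E₁ E₂ : ℕ × ℝ → ℝ}

/-- The mean squared error along bandwidths of the critical order. -/
lemma isLittleO_of_critical (hD : 0 < D)
    (hE₁ : E₁ =O[atTop ×ˢ 𝓝[>] (0 : ℝ)] fun p => (p.1 : ℝ)⁻¹ * p.2 ^ (-D / 2 + 1 / 2))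
    (hE₂ : E₂ =o[atTop ×ˢ 𝓝[>] (0 : ℝ)] fun p => p.2 ^ 2)
    (hm : ∀ n b, m n b = leading D A G n b + E₁ (n, b) + E₂ (n, b))
    {b : ℕ → ℝ} {lam : ℝ} (hb : ∀ᶠ n in atTop, 0 < b n) (hlam : 0 < lam)
    (h : Tendsto (fun n : ℕ => (n : ℝ) ^ (2 / (D + 4)) * b n) atTop (𝓝 lam)) :
    (fun n : ℕ => m n (b n) - (n : ℝ) ^ (-4 / (D + 4)) * (lam ^ (-D / 2) * A + lam ^ 2 * G))
      =o[atTop] fun n : ℕ => (n : ℝ) ^ (-4 / (D + 4)) := by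
  have ht := tendsto_bandwidth hD hb h
  have hb0 : Tendsto b atTop (𝓝 0) := (tendsto_nhdsWithin_iff.1 (tendsto_snd.comp ht)).1
  have hpow := h.rpow_const (p := -D / 2) (Or.inl hlam.ne')
  have hsq := h.pow 2
  have h1 : (fun n : ℕ => (n : ℝ) ^ (-4 / (D + 4)) *
      ((((n : ℝ) ^ (2 / (D + 4)) * b n) ^ (-D / 2) * A +
        ((n : ℝ) ^ (2 / (D + 4)) * b n) ^ 2 * G) - (lam ^ (-D / 2) * A + lam ^ 2 * G)))
      =o[atTop] fun n : ℕ => (n : ℝ) ^ (-4 / (D + 4)) := by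
    refine isLittleO_mul_of_tendsto_zero ?_
    have := ((hpow.mul_const A).add (hsq.mul_const G)).sub_const
      (lam ^ (-D / 2) * A + lam ^ 2 * G)
    rwa [sub_self] at this
  -- Compared with the leading variance, `E₁` has an extra factor `b n ^ (1 / 2)`, which tends to
  -- zero.
  have h2 : (fun n => E₁ (n, b n)) =o[atTop] fun n : ℕ => (n : ℝ) ^ (-4 / (D + 4)) := by
    refine (hE₁.comp_tendsto ht).trans_isLittleO ?_
    have hw : Tendsto (fun n : ℕ => ((n : ℝ) ^ (2 / (D + 4)) * b n) ^ (-D / 2) *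
        b n ^ (1 / 2 : ℝ)) atTop (𝓝 0) := by
      have := hpow.mul (hb0.rpow_const (p := 1 / 2) (Or.inr (by norm_num)))
      rwa [Real.zero_rpow (by norm_num), mul_zero] at this
    refine (isLittleO_mul_of_tendsto_zero hw).congr' ?_ EventuallyEq.rfl
    filter_upwards [hb, eventually_gt_atTop 0] with n hbn hn
    simp only [Function.comp]
    rw [Real.rpow_add hbn, ← mul_assoc, ← mul_assoc, rescale_variance hD hn hbn]
  have h3 : (fun n => E₂ (n, b n)) =o[atTop] fun n : ℕ => (n : ℝ) ^ (-4 / (D + 4)) := by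
    refine (hE₂.comp_tendsto ht).trans_isBigO ?_
    have hO := (isBigO_refl (fun n : ℕ => (n : ℝ) ^ (-4 / (D + 4))) atTop).mul (hsq.isBigO_one ℝ)
    refine hO.congr' ?_ (Eventually.of_forall fun n => mul_one _)
    filter_upwards [eventually_gt_atTop 0] with n hn
    exact (rescale_sq hD hn (b n)).symm
  refine ((h1.add h2).add h3).congr' ?_ EventuallyEq.rfl
  filter_upwards [hb, eventually_gt_atTop 0] with n hbn hn
  rw [hm, leading, rescale_variance hD hn hbn]
  conv_rhs => rw [rescale_sq hD hn (b n)]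
  ring

/-- The limit of the rescaled optimal bandwidth. -/
noncomputable def optScale (D A G : ℝ) : ℝ := (D / 4 * (A / G)) ^ (2 / (D + 4))

lemma optScale_pos (hD : 0 < D) (hA : 0 < A) (hG : 0 < G) : 0 < optScale D A G := by
  unfold optScale; positivity

/-- Together with `optScale_sq`, this says that at the optimum the squared bias is `D / 4` times the
variance. That is the first order condition, and the source of the factor `1 + D / 4`. -/
lemma optScale_rpow (hD : 0 < D) (hA : 0 < A) (hG : 0 < G) :
    optScale D A G ^ (-D / 2) * A =
      (D / 4) ^ (-(D / (D + 4))) * (A ^ (4 / (D + 4)) * G ^ (D / (D + 4))) := by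
  rw [optScale, ← Real.rpow_mul (by positivity),
    show 2 / (D + 4) * (-D / 2) = -(D / (D + 4)) by field_simp,
    Real.mul_rpow (by positivity) (by positivity), Real.div_rpow hA.le hG.le,
    Real.rpow_neg hG.le, div_inv_eq_mul]
  have : A ^ (4 / (D + 4)) = A ^ (-(D / (D + 4))) * A := by
    conv_rhs => rw [← Real.rpow_add_one hA.ne']
    congr 1
    field_simp
    ring
  rw [this]
  ring

lemma optScale_sq (hD : 0 < D) (hA : 0 < A) (hG : 0 < G) :
    optScale D A G ^ 2 * G =
      D / 4 * ((D / 4) ^ (-(D / (D + 4))) * (A ^ (4 / (D + 4)) * G ^ (D / (D + 4)))) := by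
  rw [optScale, ← Real.rpow_natCast, ← Real.rpow_mul (by positivity),
    show 2 / (D + 4) * ((2 : ℕ) : ℝ) = 4 / (D + 4) by push_cast; ring,
    Real.mul_rpow (by positivity) (by positivity), Real.div_rpow hA.le hG.le]
  have h1 : ∀ x : ℝ, 0 < x → x ^ (-(D / (D + 4))) * x = x ^ (4 / (D + 4)) := by
    intro x hx
    rw [← Real.rpow_add_one hx.ne']
    congr 1
    field_simp
    ring
  have h2 : G ^ (D / (D + 4)) * G ^ (4 / (D + 4)) = G := by
    rw [← Real.rpow_add hG, ← add_div, div_self (by positivity), Real.rpow_one]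
  rw [← h1 (D / 4) (by positivity)]
  have hG4 : 0 < G ^ (4 / (D + 4)) := by positivity
  field_simp
  linear_combination -h2

/-- A critical point of the leading part is its strict minimiser. -/
lemma leading_lt_of_critical (hD : 0 < D) {c b₀ b : ℝ} (hc : 0 < c) (hb₀ : 0 < b₀)
    (hb : 0 < b) (hne : b ≠ b₀) (hcrit : D / 4 * (c * b₀ ^ (-D / 2)) = b₀ ^ 2 * G) :
    c * b₀ ^ (-D / 2) + b₀ ^ 2 * G < c * b ^ (-D / 2) + b ^ 2 * G := by
  -- By `hcrit`, division by `c * b₀ ^ (-D / 2)` turns the claim into `1 + D / 4 < v ^ (-(D / 4)) +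
  -- D / 4 * v`, the strict tangent line inequality at `v = 1`, obtained from `log v < v - 1`.
  set v : ℝ := (b / b₀) ^ 2 with hv
  have hr : 0 < b / b₀ := div_pos hb hb₀
  have hv0 : 0 < v := by positivity
  have hv1 : v ≠ 1 := by
    intro h
    have := (pow_eq_one_iff_of_nonneg hr.le two_ne_zero).1 h
    exact hne ((div_eq_one_iff_eq hb₀.ne').1 this)
  have hX : 0 < c * b₀ ^ (-D / 2) := by positivity
  have e1 : b ^ (-D / 2) = b₀ ^ (-D / 2) * v ^ (-(D / 4)) := by
    rw [hv, ← Real.rpow_natCast, ← Real.rpow_mul hr.le,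
      show ((2 : ℕ) : ℝ) * -(D / 4) = -D / 2 by push_cast; ring,
      ← Real.mul_rpow hb₀.le hr.le, mul_div_cancel₀ _ hb₀.ne']
  have e2 : b ^ 2 = b₀ ^ 2 * v := by
    rw [hv, div_pow, mul_div_cancel₀ _ (by positivity)]
  have hlog := Real.log_lt_sub_one_of_pos hv0 hv1
  have hpow : 1 - D / 4 * (v - 1) < v ^ (-(D / 4)) := by
    rw [Real.rpow_def_of_pos hv0]
    have := Real.add_one_le_exp (Real.log v * -(D / 4))
    have := mul_lt_mul_of_pos_left hlog (by positivity : 0 < D / 4)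
    linarith
  have := mul_lt_mul_of_pos_left hpow hX
  rw [e1, e2, ← mul_assoc, mul_right_comm (b₀ ^ 2), ← hcrit]
  nlinarith

lemma leading_optScale_lt (hD : 0 < D) (hA : 0 < A) (hG : 0 < G) {n : ℕ} (hn : 0 < n) {b : ℝ}
    (hb : 0 < b) (hne : b ≠ (n : ℝ) ^ (-2 / (D + 4)) * optScale D A G) :
    leading D A G n ((n : ℝ) ^ (-2 / (D + 4)) * optScale D A G) < leading D A G n b := by
  have hn' : (0 : ℝ) < n := by exact_mod_cast hn
  have hl := optScale_pos hD hA hG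
  set b₀ := (n : ℝ) ^ (-2 / (D + 4)) * optScale D A G with hb₀
  have hb₀0 : 0 < b₀ := by positivity
  have hu : (n : ℝ) ^ (2 / (D + 4)) * b₀ = optScale D A G := by
    rw [hb₀, ← mul_assoc, ← Real.rpow_add hn', ← add_div, add_neg_cancel, zero_div, Real.rpow_zero,
      one_mul]
  have hcrit : D / 4 * ((n : ℝ)⁻¹ * A * b₀ ^ (-D / 2)) = b₀ ^ 2 * G := by
    rw [mul_right_comm, rescale_variance hD hn hb₀0, rescale_sq hD hn b₀, hu, mul_assoc,
      optScale_rpow hD hA hG, mul_assoc, optScale_sq hD hA hG]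
    ring
  have := leading_lt_of_critical hD (by positivity : 0 < (n : ℝ)⁻¹ * A) hb₀0 hb hne hcrit
  simpa only [leading, mul_right_comm _ _ A] using this

lemma tendsto_optScale (n₀ : ℝ) (D : ℝ) :
    Tendsto (fun n : ℕ => (n : ℝ) ^ (2 / (D + 4)) * ((n : ℝ) ^ (-2 / (D + 4)) * n₀)) atTop
      (𝓝 n₀) := by
  refine tendsto_const_nhds.congr' ?_
  filter_upwards [eventually_gt_atTop 0] with n hn
  have hn' : (0 : ℝ) < n := by exact_mod_cast hn
  rw [← mul_assoc, ← Real.rpow_add hn', ← add_div, add_neg_cancel, zero_div, Real.rpow_zero,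
    one_mul]

/-- The leading part dominates the error terms when both of its coefficients are positive. -/
lemma isLittleO_leading (hA : 0 < A) (hG : 0 < G)
    (hE₁ : E₁ =O[atTop ×ˢ 𝓝[>] (0 : ℝ)] fun p => (p.1 : ℝ)⁻¹ * p.2 ^ (-D / 2 + 1 / 2))
    (hE₂ : E₂ =o[atTop ×ˢ 𝓝[>] (0 : ℝ)] fun p => p.2 ^ 2)
    (hm : ∀ n b, m n b = leading D A G n b + E₁ (n, b) + E₂ (n, b)) :
    (fun p : ℕ × ℝ => m p.1 p.2 - leading D A G p.1 p.2) =o[atTop ×ˢ 𝓝[>] (0 : ℝ)]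
      fun p => leading D A G p.1 p.2 := by
  have hpos : ∀ᶠ p : ℕ × ℝ in atTop ×ˢ 𝓝[>] (0 : ℝ), 0 < p.2 :=
    tendsto_snd.eventually self_mem_nhdsWithin
  have h1 : (fun p : ℕ × ℝ => (p.1 : ℝ)⁻¹ * p.2 ^ (-D / 2)) =O[atTop ×ˢ 𝓝[>] (0 : ℝ)]
      fun p => leading D A G p.1 p.2 := by
    refine IsBigO.of_bound A⁻¹ ?_
    filter_upwards [hpos] with p hp
    have hx : 0 ≤ (p.1 : ℝ)⁻¹ * p.2 ^ (-D / 2) := by positivity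
    have hy : 0 ≤ p.2 ^ 2 * G := by positivity
    rw [Real.norm_of_nonneg hx, leading, Real.norm_of_nonneg (by positivity),
      le_inv_mul_iff₀ hA]
    linarith
  have h2 : (fun p : ℕ × ℝ => p.2 ^ 2) =O[atTop ×ˢ 𝓝[>] (0 : ℝ)]
      fun p => leading D A G p.1 p.2 := by
    refine IsBigO.of_bound G⁻¹ ?_
    filter_upwards [hpos] with p hp
    have hx : 0 ≤ (p.1 : ℝ)⁻¹ * p.2 ^ (-D / 2) * A := by positivity
    rw [Real.norm_of_nonneg (by positivity), leading, Real.norm_of_nonneg (by positivity),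
      le_inv_mul_iff₀ hG]
    linarith
  have hroot : Tendsto (fun p : ℕ × ℝ => p.2 ^ (1 / 2 : ℝ)) (atTop ×ˢ 𝓝[>] (0 : ℝ)) (𝓝 0) := by
    have h0 : Tendsto (fun b : ℝ => b ^ (1 / 2 : ℝ)) (𝓝 0) (𝓝 0) := by
      have := (Real.continuousAt_rpow_const 0 (1 / 2) (Or.inr (by norm_num))).tendsto
      rwa [Real.zero_rpow (by norm_num)] at this
    exact (tendsto_nhdsWithin_of_tendsto_nhds h0).comp tendsto_snd
  have h3 : (fun p : ℕ × ℝ => (p.1 : ℝ)⁻¹ * p.2 ^ (-D / 2 + 1 / 2)) =o[atTop ×ˢ 𝓝[>] (0 : ℝ)]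
      fun p => leading D A G p.1 p.2 := by
    refine (h1.mul_isLittleO ((isLittleO_one_iff ℝ).2 hroot)).congr' ?_
      (Eventually.of_forall fun p => mul_one _)
    filter_upwards [hpos] with p hp
    rw [Real.rpow_add hp, mul_assoc]
  refine ((hE₁.trans_isLittleO h3).add (hE₂.trans_isBigO h2)).congr_left fun p => ?_
  rw [hm]
  ring

/-- Both MSE values lie within a factor `1 ± η / 2` of their leading parts, which are ordered by
minimality; it remains that `(1 - η) * (1 + η / 2) ≤ 1 - η / 2`. -/
lemma eventually_opt_le (hD : 0 < D) (hA : 0 < A) (hG : 0 < G)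
    (hE₁ : E₁ =O[atTop ×ˢ 𝓝[>] (0 : ℝ)] fun p => (p.1 : ℝ)⁻¹ * p.2 ^ (-D / 2 + 1 / 2))
    (hE₂ : E₂ =o[atTop ×ˢ 𝓝[>] (0 : ℝ)] fun p => p.2 ^ 2)
    (hm : ∀ n b, m n b = leading D A G n b + E₁ (n, b) + E₂ (n, b)) {ε : ℝ} (hε : 0 < ε) :
    ∀ᶠ p : ℕ × ℝ in atTop ×ˢ 𝓝[>] (0 : ℝ),
      (1 - ε) * m p.1 ((p.1 : ℝ) ^ (-2 / (D + 4)) * optScale D A G) ≤ m p.1 p.2 := by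
  have hl := optScale_pos hD hA hG
  -- Truncation keeps `1 - η` nonnegative; replacing `ε` by `η` is harmless as the MSE is
  -- nonnegative.
  set η : ℝ := min ε 1 with hη
  have hη0 : 0 < η := by positivity
  have hη1 : η ≤ 1 := min_le_right _ _
  have hopt : ∀ᶠ n : ℕ in atTop, 0 < (n : ℝ) ^ (-2 / (D + 4)) * optScale D A G := by
    filter_upwards [eventually_gt_atTop 0] with n hn
    have hn' : (0 : ℝ) < n := by exact_mod_cast hn
    positivity
  have ho := isLittleO_iff.1 (isLittleO_leading hA hG hE₁ hE₂ hm) (half_pos hη0)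
  have ho' := (tendsto_bandwidth hD hopt (tendsto_optScale _ D)).eventually ho
  have hpos : ∀ᶠ p : ℕ × ℝ in atTop ×ˢ 𝓝[>] (0 : ℝ), 0 < p.2 :=
    tendsto_snd.eventually self_mem_nhdsWithin
  filter_upwards [ho, hpos, tendsto_fst.eventually ho', tendsto_fst.eventually hopt,
    tendsto_fst.eventually (eventually_gt_atTop 0)] with p h1 hb h2 hb₀ hn
  set b₀ := (p.1 : ℝ) ^ (-2 / (D + 4)) * optScale D A G with hb₀def
  have hle : leading D A G p.1 b₀ ≤ leading D A G p.1 p.2 := by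
    by_cases h : p.2 = b₀
    · rw [h]
    · exact (leading_optScale_lt hD hA hG hn hb h).le
  have hL0 : 0 ≤ leading D A G p.1 b₀ := by unfold leading; positivity
  have hL : 0 ≤ leading D A G p.1 p.2 := hL0.trans hle
  rw [Real.norm_eq_abs, Real.norm_of_nonneg hL0, abs_le] at h2
  rw [Real.norm_eq_abs, Real.norm_of_nonneg hL, abs_le] at h1
  have hm0 : 0 ≤ m p.1 b₀ := by nlinarith
  calc (1 - ε) * m p.1 b₀ ≤ (1 - η) * m p.1 b₀ := by
        gcongr
        exact min_le_left _ _
    _ ≤ (1 - η) * ((1 + η / 2) * leading D A G p.1 b₀) :=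
        mul_le_mul_of_nonneg_left (by linarith) (by linarith)
    _ ≤ (1 - η / 2) * leading D A G p.1 b₀ := by nlinarith [mul_nonneg (sq_nonneg η) hL0]
    _ ≤ (1 - η / 2) * leading D A G p.1 p.2 := mul_le_mul_of_nonneg_left hle (by linarith)
    _ ≤ m p.1 p.2 := by linarith

end Bandwidth

end DirichletKernel

/-! ### The mean squared error theorem. -/

theorem mainTheorem6 {d : ℕ} (hd : 0 < d) (f : (Fin d → ℝ) → ℝ)
    (hf : DirichletKernel.IsSimplexDensity f)
    (hf2 : ContDiffOn ℝ 2 f (DirichletKernel.simplex d)) :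
    -- `mse s n b` is the common value, for all samples of size `n` from `f`, of `MSE[f̂_{n,b}(s)]`
    ∃ mse : (Fin d → ℝ) → ℕ → ℝ → ℝ,
      (∀ (Ω : Type*) [MeasurableSpace Ω] (P : Measure Ω) [IsProbabilityMeasure P]
        (n : ℕ) (X : Fin n → Ω → (Fin d → ℝ)) (b : ℝ),
        0 < n → 0 < b → DirichletKernel.IsSample P f X →
          ∀ s ∈ DirichletKernel.simplexInt d,
            MemLp (DirichletKernel.estimator X b s) 2 P ∧
            DirichletKernel.meanSquaredError P f X b s = mse s n b ∧
            DirichletKernel.meanSquaredError P f X b s =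
              variance (DirichletKernel.estimator X b s) P +
                DirichletKernel.bias P f X b s ^ 2) ∧
      -- the expansion as `n → ∞` and `b → 0`: the first remainder is bounded locally in `s`,
      -- the second one is small uniformly in `s`
      (∃ R₁ R₂ : (Fin d → ℝ) → ℕ × ℝ → ℝ,
        (∀ s ∈ DirichletKernel.simplexInt d,
          R₁ s =O[atTop ×ˢ 𝓝[>] (0 : ℝ)]
            fun p => (p.1 : ℝ)⁻¹ * p.2 ^ (-(d : ℝ) / 2 + 1 / 2)) ∧
        (∀ ε : ℝ, 0 < ε → ∀ᶠ p : ℕ × ℝ in atTop ×ˢ 𝓝[>] (0 : ℝ),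
          ∀ s ∈ DirichletKernel.simplexInt d, |R₂ s p| ≤ ε * p.2 ^ 2) ∧
        ∀ s ∈ DirichletKernel.simplexInt d, ∀ (n : ℕ) (b : ℝ), 0 < n → 0 < b →
          mse s n b =
            (n : ℝ)⁻¹ * b ^ (-(d : ℝ) / 2) * (DirichletKernel.psi s * f s)
              + b ^ 2 * DirichletKernel.gTerm f s ^ 2 + R₁ s (n, b) + R₂ s (n, b)) ∧
      -- the optimal bandwidth
      (∀ s ∈ DirichletKernel.simplexInt d, f s * DirichletKernel.gTerm f s ≠ 0 →
        (∀ n : ℕ, 0 < n → 0 < DirichletKernel.bOpt f s n ∧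
          ∀ b : ℝ, 0 < b → b ≠ DirichletKernel.bOpt f s n →
            DirichletKernel.leadingMSE f s n (DirichletKernel.bOpt f s n) <
              DirichletKernel.leadingMSE f s n b) ∧
        (∀ ε : ℝ, 0 < ε → ∀ᶠ p : ℕ × ℝ in atTop ×ˢ 𝓝[>] (0 : ℝ),
          (1 - ε) * mse s p.1 (DirichletKernel.bOpt f s p.1) ≤ mse s p.1 p.2) ∧
        ((fun n : ℕ => mse s n (DirichletKernel.bOpt f s n) -
            (n : ℝ) ^ (-4 / ((d : ℝ) + 4)) *
              ((1 + (d : ℝ) / 4) / ((d : ℝ) / 4) ^ ((d : ℝ) / ((d : ℝ) + 4))) *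
              ((DirichletKernel.psi s * f s) ^ (4 / ((d : ℝ) + 4)) /
                (DirichletKernel.gTerm f s ^ 2) ^ (-(d : ℝ) / ((d : ℝ) + 4))))
          =o[atTop] fun n : ℕ => (n : ℝ) ^ (-4 / ((d : ℝ) + 4)))) ∧
      -- bandwidths with `n^{2/(d+4)} b → lam`
      (∀ s ∈ DirichletKernel.simplexInt d,
        ∀ (b : ℕ → ℝ) (lam : ℝ), (∀ n, 0 < b n) → 0 < lam →
        Tendsto (fun n : ℕ => (n : ℝ) ^ (2 / ((d : ℝ) + 4)) * b n) atTop (𝓝 lam) →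
        (fun n : ℕ => mse s n (b n) -
            (n : ℝ) ^ (-4 / ((d : ℝ) + 4)) *
              (lam ^ (-(d : ℝ) / 2) * (DirichletKernel.psi s * f s) +
                lam ^ 2 * DirichletKernel.gTerm f s ^ 2))
          =o[atTop] fun n : ℕ => (n : ℝ) ^ (-4 / ((d : ℝ) + 4))) := by
  have hd' : (0 : ℝ) < d := by exact_mod_cast hd
  have hm : ∀ s n b, DirichletKernel.mseOf f s n b =
      DirichletKernel.leading d (DirichletKernel.psi s * f s) (DirichletKernel.gTerm f s ^ 2) n b +
        DirichletKernel.varianceRemainder f s (n, b) + DirichletKernel.sqBiasRemainder f s (n, b) :=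
    DirichletKernel.mseOf_eq f
  refine ⟨DirichletKernel.mseOf f, ?_, ⟨DirichletKernel.varianceRemainder f,
    DirichletKernel.sqBiasRemainder f, fun s hs =>
      DirichletKernel.isBigO_varianceRemainder hd hf2 hs,
    fun ε hε => DirichletKernel.sqBiasRemainder_le hf2 hε, fun s _ n b _ _ => hm s n b⟩, ?_, ?_⟩
  · intro Ω _ P _ n X b hn hb hX s hs
    have hsS := DirichletKernel.simplexInt_subset_simplex d hs
    exact ⟨DirichletKernel.memLp_estimator hX hsS hb,
      DirichletKernel.meanSquaredError_eq_mseOf hn hf hX hsS hb,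
      DirichletKernel.meanSquaredError_eq_variance_add hX hsS hb⟩
  · intro s hs hfg
    have hsS := DirichletKernel.simplexInt_subset_simplex d hs
    have hf0 : 0 < f s := lt_of_le_of_ne (hf.nonneg s hsS) (left_ne_zero_of_mul hfg).symm
    have hA : 0 < DirichletKernel.psi s * f s := mul_pos (DirichletKernel.psi_pos hs) hf0
    have hG : 0 < DirichletKernel.gTerm f s ^ 2 :=
      sq_pos_of_ne_zero (right_ne_zero_of_mul hfg)
    have hl := DirichletKernel.optScale_pos hd' hA hG
    have hE₁ := DirichletKernel.isBigO_varianceRemainder hd hf2 hs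
    have hE₂ := DirichletKernel.isLittleO_sqBiasRemainder hf2 hs
    have hpos : ∀ n : ℕ, 0 < n → 0 < DirichletKernel.bOpt f s n := fun n hn => by
      have hn' : (0 : ℝ) < n := by exact_mod_cast hn
      exact mul_pos (Real.rpow_pos_of_pos hn' _) hl
    refine ⟨fun n hn => ⟨hpos n hn, fun b hb hne =>
      DirichletKernel.leading_optScale_lt hd' hA hG hn hb hne⟩,
      fun ε hε => DirichletKernel.eventually_opt_le hd' hA hG hE₁ hE₂ (hm s) hε, ?_⟩
    -- The optimal bandwidth is the critical case with limit `optScale`. Positivity is only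
    -- eventual, since at `n = 0` the real power makes it `0`.
    have h := DirichletKernel.isLittleO_of_critical hd' hE₁ hE₂ (hm s)
      ((eventually_gt_atTop 0).mono hpos) hl (DirichletKernel.tendsto_optScale _ d)
    refine h.congr_left fun n => ?_
    rw [DirichletKernel.optScale_rpow hd' hA hG, DirichletKernel.optScale_sq hd' hA hG,
      neg_div (d + 4 : ℝ) d, Real.rpow_neg (by positivity), Real.rpow_neg hG.le, div_inv_eq_mul]
    simp only [DirichletKernel.bOpt]
    ring
  · intro s hs b lam hb hlam h
    exact DirichletKernel.isLittleO_of_critical hd'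
      (DirichletKernel.isBigO_varianceRemainder hd hf2 hs)
      (DirichletKernel.isLittleO_sqBiasRemainder hf2 hs) (hm s) (Eventually.of_forall hb) hlam h
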